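/- Let $w(z)=e^{-z^2}\operatorname{erfc}(-iz)$, $z\in\mathbb{C}$, be the Faddeeva function, where $\operatorname{erfc}(z)=\frac{2}{\sqrt{\pi}}\int_z^{\infty}e^{-t^2}\,dt$ is the complementary error function (the path of integration being, e.g., the horizontal ray $z+s$, $0<s<\infty$). For $N\in\{0,1,2,\dots\}$ put $$h:=\sqrt{\pi/(N+1)},\qquad t_k:=(k+\tfrac12)h,\qquad \tau_k:=kh,$$ $$w_N^{\mathrm M}(z):=\frac{2ihz}{\pi}\sum_{k=0}^{N}\frac{e^{-t_k^2}}{z^2-t_k^2},\qquad w_N^{\mathrm{MM}}(z):=\frac{2e^{-z^2}}{1+e^{-2i\pi z/h}}+w_N^{\mathrm M}(z),$$ $$w_N^{\mathrm{MT}}(z):=\frac{2e^{-z^2}}{1-e^{-2i\pi z/h}}+\frac{ih}{\pi z}+\frac{2ihz}{\pi}\sum_{k=1}^{N}\frac{e^{-\tau_k^2}}{z^2-\tau_k^2}.$$ With $\varphi(t):=t-\lfloor t\rfloor$ the fractional part of $t$, define, for $z=x+iy$ with $x,y\ge 0$, $$w_N(z):=\begin{cases} w_N^{\mathrm M}(z),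 & \text{if } y\ge\max(x,\pi/h),\\ w_N^{\mathrm{MT}}(z), & \text{if } y<x \text{ and } 1/4\le\varphi(x/h)\le 3/4,\\ w_N^{\mathrm{MM}}(z), & \text{otherwise},\end{cases}$$ and extend this to all of $\mathbb{C}$ by $w_N(z):=\overline{w_N(-\overline z)}$ if $y\ge 0$ and $x<0$, and $w_N(z):=2e^{-z^2}-w_N(-z)$ if $y<0$. Let $$C_1:=\frac{2(2e+\sqrt\pi)}{e^{\pi}\sqrt{e\pi}\,\bigl(1-e^{-2\pi+\sqrt{2\pi}}\bigr)}+\frac{10\sqrt2\,(1+2\pi)}{e^{\pi}\pi^2},$$ $$C_2:=\frac{2\sqrt2\,(1+\sqrt\pi)(2e+\sqrt\pi)}{e^{\pi}\sqrt e\,\bigl(1-e^{-2\pi+\sqrt{2\pi}}\bigr)}+\frac{10(1+2\pi)(2\pi+\sqrt2)}{e^{\pi}\pi^2}.$$ Then $C_1\approx 0.67$ and $C_2\approx 3.97$ (both correct to two decimal places, i.e. with error less than $0.005$), and for every $N\in\{0,1,2,\dots\}$, $$|w(z)-w_N(z)|\le C_1e^{-\pi N}\quad\text{for all } z\in\mathbb{C},$$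 and, for all $z\in\mathbb{C}$ with $\operatorname{Im}z\ge 0$, $w(z)\neq 0$ and $$\frac{|w(z)-w_N(z)|}{|w(z)|}\le C_2\sqrt{N+1}\,e^{-\pi N}.$$ -/

import Mathlib

noncomputable section

namespace Faddeeva

/-- The complementary error function `erfc z = (2/√π) ∫_z^∞ e^{-t²} dt` for complex `z`, the path
of integration being the horizontal ray `z + s`, `0 < s < ∞`. -/
def erfc (z : ℂ) : ℂ :=
  (2 / (Real.sqrt Real.pi : ℂ)) * ∫ s in Set.Ioi (0 : ℝ), Complex.exp (-(z + (s : ℂ)) ^ 2)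

/-- The Faddeeva function `w(z) = e^{-z²} erfc(-i z)`. -/
def w (z : ℂ) : ℂ := Complex.exp (-z ^ 2) * erfc (-Complex.I * z)

/-- The step size `h = √(π / (N + 1))`. -/
def step (N : ℕ) : ℝ := Real.sqrt (Real.pi / ((N : ℝ) + 1))

/-- The midpoint nodes `t_k = (k + 1/2) h`. -/
def midNode (N k : ℕ) : ℝ := ((k : ℝ) + 1 / 2) * step N

/-- The trapezoidal nodes `τ_k = k h`. -/
def trapNode (N k : ℕ) : ℝ := (k : ℝ) * step N

/-- The truncated midpoint rule approximation `w_N^M`. -/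
def wM (N : ℕ) (z : ℂ) : ℂ :=
  (2 * Complex.I * (step N : ℂ) * z / (Real.pi : ℂ)) *
    ∑ k ∈ Finset.range (N + 1),
      Complex.exp (-(midNode N k : ℂ) ^ 2) / (z ^ 2 - (midNode N k : ℂ) ^ 2)

/-- The truncated modified midpoint rule approximation `w_N^MM`. -/
def wMM (N : ℕ) (z : ℂ) : ℂ :=
  2 * Complex.exp (-z ^ 2) /
      (1 + Complex.exp (-2 * Complex.I * (Real.pi : ℂ) * z / (step N : ℂ))) +
    wM N z

/-- The truncated modified trapezoidal rule approximation `w_N^MT`. -/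
def wMT (N : ℕ) (z : ℂ) : ℂ :=
  2 * Complex.exp (-z ^ 2) /
      (1 - Complex.exp (-2 * Complex.I * (Real.pi : ℂ) * z / (step N : ℂ))) +
    Complex.I * (step N : ℂ) / ((Real.pi : ℂ) * z) +
    (2 * Complex.I * (step N : ℂ) * z / (Real.pi : ℂ)) *
      ∑ k ∈ Finset.Icc 1 N,
        Complex.exp (-(trapNode N k : ℂ) ^ 2) / (z ^ 2 - (trapNode N k : ℂ) ^ 2)

open Classical in
/-- The approximation `w_N` in the closed first quadrant (only used for `0 ≤ Re z`, `0 ≤ Im z`). -/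
def wQuadrant (N : ℕ) (z : ℂ) : ℂ :=
  if max z.re (Real.pi / step N) ≤ z.im then wM N z
  else if z.im < z.re ∧ 1 / 4 ≤ Int.fract (z.re / step N) ∧ Int.fract (z.re / step N) ≤ 3 / 4 then
    wMT N z
  else wMM N z

open Classical in
/-- The approximation `w_N` in the closed upper half-plane (only used for `0 ≤ Im z`): for
`Re z < 0` it is the conjugate of the value at the mirror point `-conj z`. -/
def wUpper (N : ℕ) (z : ℂ) : ℂ :=
  if z.re < 0 then (starRingEnd ℂ) (wQuadrant N (-(starRingEnd ℂ) z)) else wQuadrant N z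

open Classical in
/-- The approximation `w_N` in the whole complex plane. -/
def wApprox (N : ℕ) (z : ℂ) : ℂ :=
  if z.im < 0 then 2 * Complex.exp (-z ^ 2) - wUpper N (-z) else wUpper N z

/-- The constant of the absolute error bound. -/
def C₁ : ℝ :=
  2 * (2 * Real.exp 1 + Real.sqrt Real.pi) /
      (Real.exp Real.pi * Real.sqrt (Real.exp 1 * Real.pi) *
        (1 - Real.exp (-2 * Real.pi + Real.sqrt (2 * Real.pi)))) +
    10 * Real.sqrt 2 * (1 + 2 * Real.pi) / (Real.exp Real.pi * Real.pi ^ 2)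

/-- The constant of the relative error bound. -/
def C₂ : ℝ :=
  2 * Real.sqrt 2 * (1 + Real.sqrt Real.pi) * (2 * Real.exp 1 + Real.sqrt Real.pi) /
      (Real.exp Real.pi * Real.sqrt (Real.exp 1) *
        (1 - Real.exp (-2 * Real.pi + Real.sqrt (2 * Real.pi)))) +
    10 * (1 + 2 * Real.pi) * (2 * Real.pi + Real.sqrt 2) / (Real.exp Real.pi * Real.pi ^ 2)

end Faddeeva

end

namespace Faddeeva

open MeasureTheory Set Filter Topology Complex

/-! Write `w z` as `(2/√π) ∫₀^∞ exp(-s² + 2izs) ds`. For fixed `s`, Poisson summation applied to a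
Gaussian sampled at `(k+δ)h`, followed by integration in `s`, shows for `Im z > 0` that the full
quadrature sum over these nodes equals `∑ₙ e^{2πiδn} e^{-(an)²} w(z + ian)` with `a = π/h`
(`exists_hasSum_nodes`). The term `n = 0` is `w z`; everything else is discretization error.
Midpoint nodes are `δ = 1/2`, trapezoidal nodes `δ = 0`.

The shifts `z - ib`, `b = a(m+1)`, may fall into the lower half-plane, where `w` is large. The
reflection `w z + w (-z) = 2e^{-z²}` replaces them by `-z + ib` at the price of terms forming a
geometric series, whose sum is exactly the correction in `wMM` and `wMT` (`hasSum_shifted_sub`). In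
the upper half-plane `‖w‖ ≤ 1` and `√π ‖z w z‖ ≤ 2`, so the remaining series is of size `e^{-a²}`
(`term_sub_le`). High above the axis the uncorrected series is already that small (`term_add_le`).

The step `h` satisfies `(N+1)h² = π`, which makes `a²` and `((N+1)h)²` both equal to `π(N+1)`, so
truncation costs as much as discretization (`tail_le`). The switch between the two rules keeps `z`
at distance at least `h/4` from the omitted nodes when `Im z < Re z`. Altogether the absolute error
is at most `8e^{-π(N+1)}`, and a companion bound carries the weight `√π ‖z‖`.

For the relative error, Phragmén–Lindelöf gives `Re((1 - i√π z) w z) ≥ 1` in the closed upper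
half-plane (`one_le_re`), hence `1/‖w z‖ ≤ 1 + √π ‖z‖`, and the two error bounds add up. Since `e^π
> 23`, the resulting constants `8/23` and `56/23` lie well below `C₁` and `C₂`. -/

/-! ### Integral representation, symmetries and upper bounds for `w`. -/

lemma integrable_gauss (c : ℂ) : Integrable (fun s : ℝ => cexp (-(s : ℂ) ^ 2 + c * s)) := by
  have := integrable_cexp_quadratic (b := 1) (by simp) c 0
  refine this.congr (Eventually.of_forall fun s => ?_)
  simp

lemma norm_gauss (c : ℂ) (s : ℝ) :
    ‖cexp (-(s : ℂ) ^ 2 + c * s)‖ = Real.exp (-s ^ 2 + c.re * s) := by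
  rw [Complex.norm_exp]
  congr 1
  simp [← ofReal_pow]

lemma integrable_gauss_real (c : ℝ) : Integrable (fun s : ℝ => Real.exp (-s ^ 2 + c * s)) := by
  have := (integrable_gauss c).norm
  simp_rw [norm_gauss] at this
  simpa using this

lemma integrable_mul_gauss (c : ℂ) :
    IntegrableOn (fun s : ℝ => (s : ℂ) * cexp (-(s : ℂ) ^ 2 + c * s)) (Ioi 0) := by
  refine Integrable.mono' (integrable_gauss_real (c.re + 1)).integrableOn
    (by fun_prop) ?_
  filter_upwards [ae_restrict_mem measurableSet_Ioi] with s hs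
  have hs : 0 < s := hs
  rw [norm_mul, norm_gauss, norm_real, Real.norm_of_nonneg hs.le,
    show -s ^ 2 + (c.re + 1) * s = s + (-s ^ 2 + c.re * s) by ring, Real.exp_add s]
  exact mul_le_mul_of_nonneg_right (by linarith [Real.add_one_le_exp s]) (Real.exp_pos _).le

lemma integral_gauss_full (z : ℂ) :
    ∫ s : ℝ, cexp (-(s : ℂ) ^ 2 + 2 * I * z * s) = (Real.sqrt Real.pi : ℂ) * cexp (-z ^ 2) := by
  have := integral_cexp_quadratic (b := -1) (by simp) (2 * I * z) 0
  simp only [add_zero] at this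
  rw [show (fun s : ℝ => cexp (-(s : ℂ) ^ 2 + 2 * I * z * s)) =
    fun s : ℝ => cexp (-1 * (s : ℂ) ^ 2 + 2 * I * z * s) by ext s; simp, this]
  congr 1
  · rw [Real.sqrt_eq_rpow, ofReal_cpow Real.pi_pos.le]; simp
  · congr 1
    ring_nf; rw [I_sq]; ring

/-- Expanding `-(s - iz)² = z² + 2izs - s²` cancels the prefactor `e^{-z²}`. -/
lemma w_eq_integral (z : ℂ) :
    w z = (2 / (Real.sqrt Real.pi : ℂ)) *
      ∫ s in Ioi (0 : ℝ), cexp (-(s : ℂ) ^ 2 + 2 * I * z * s) := by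
  unfold w erfc
  rw [mul_left_comm, ← integral_const_mul]
  congr 2
  ext s
  rw [← Complex.exp_add]
  congr 1
  ring_nf; rw [I_sq]; ring

lemma sqrt_pi_pos : 0 < Real.sqrt Real.pi := Real.sqrt_pos.2 Real.pi_pos

lemma sqrt_pi_ne : (Real.sqrt Real.pi : ℂ) ≠ 0 := by exact_mod_cast sqrt_pi_pos.ne'

lemma sq_sqrt_pi : Real.sqrt Real.pi ^ 2 = Real.pi := Real.sq_sqrt Real.pi_pos.le

/-- The substitution `s ↦ -s` turns the integral for `-z` into the negative half-line part of the
one for `z`; together they form a full Gaussian Fourier integral. -/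
lemma w_add_w_neg (z : ℂ) : w z + w (-z) = 2 * cexp (-z ^ 2) := by
  have h1 : ∫ s in Ioi (0 : ℝ), cexp (-(s : ℂ) ^ 2 + 2 * I * (-z) * s) =
      ∫ s in Iic (0 : ℝ), cexp (-(s : ℂ) ^ 2 + 2 * I * z * s) := by
    have := integral_comp_neg_Ioi (0 : ℝ) (fun s : ℝ => cexp (-(s : ℂ) ^ 2 + 2 * I * z * s))
    rw [neg_zero] at this
    rw [← this]
    congr 1; ext s; congr 1; push_cast; ring
  have h2 := intervalIntegral.integral_Iic_add_Ioi (μ := volume) (b := (0 : ℝ))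
    (integrable_gauss (2 * I * z)).integrableOn (integrable_gauss (2 * I * z)).integrableOn
  rw [w_eq_integral, w_eq_integral, h1, ← mul_add, add_comm, h2, integral_gauss_full]
  have := sqrt_pi_ne
  field_simp

lemma conj_w (z : ℂ) : (starRingEnd ℂ) (w z) = w (-(starRingEnd ℂ) z) := by
  rw [w_eq_integral, w_eq_integral, map_mul, ← integral_conj]
  congr 1
  · simp [map_ofNat]
  · congr 1; ext s
    rw [← Complex.exp_conj]
    congr 1
    simp [map_ofNat]

lemma integral_gauss_half : ∫ s in Ioi (0 : ℝ), Real.exp (-s ^ 2) = Real.sqrt Real.pi / 2 := by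
  have := integral_gaussian_Ioi 1
  simpa using this

lemma norm_w_le_one {z : ℂ} (hz : 0 ≤ z.im) : ‖w z‖ ≤ 1 := by
  have h : ‖∫ s in Ioi (0 : ℝ), cexp (-(s : ℂ) ^ 2 + 2 * I * z * s)‖ ≤ Real.sqrt Real.pi / 2 := by
    rw [← integral_gauss_half]
    refine norm_integral_le_of_norm_le ?_ ?_
    · simpa [IntegrableOn] using (integrable_gauss_real 0).integrableOn (s := Ioi 0)
    · filter_upwards [ae_restrict_mem measurableSet_Ioi] with s hs
      have hs : 0 < s := hs
      rw [norm_gauss]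
      gcongr
      have : (2 * I * z).re = - (2 * z.im) := by simp
      rw [this]
      nlinarith [mul_nonneg hz hs.le]
  rw [w_eq_integral, norm_mul, norm_div, norm_real, Real.norm_of_nonneg sqrt_pi_pos.le]
  have := sqrt_pi_pos
  calc _ ≤ ‖(2 : ℂ)‖ / √Real.pi * (√Real.pi / 2) := by gcongr
    _ = 1 := by rw [Complex.norm_ofNat]; field_simp

/-- Integration by parts. It yields both the decay of `w` at infinity and the differential equation
`w' = 2i/√π - 2zw`. -/
lemma integral_mul_gauss (z : ℂ) :
    2 * ∫ s in Ioi (0 : ℝ), (s : ℂ) * cexp (-(s : ℂ) ^ 2 + 2 * I * z * s) =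
      1 + I * (Real.sqrt Real.pi : ℂ) * z * w z := by
  have hd : ∀ s ∈ Ici (0 : ℝ), HasDerivAt (fun s : ℝ => cexp (-(s : ℂ) ^ 2 + 2 * I * z * s))
      (-2 * ((s : ℂ) * cexp (-(s : ℂ) ^ 2 + 2 * I * z * s)) +
        2 * I * z * cexp (-(s : ℂ) ^ 2 + 2 * I * z * s)) s := by
    intro s _
    have h1 : HasDerivAt (fun s : ℂ => cexp (-s ^ 2 + 2 * I * z * s))
        (-2 * ((s : ℂ) * cexp (-(s : ℂ) ^ 2 + 2 * I * z * s)) +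
        2 * I * z * cexp (-(s : ℂ) ^ 2 + 2 * I * z * s)) (s : ℂ) := by
      have h2 : HasDerivAt (fun s : ℂ => -s ^ 2 + 2 * I * z * s) (-(2 * s) + 2 * I * z) (s : ℂ) := by
        have := ((hasDerivAt_pow 2 (s : ℂ)).neg).add ((hasDerivAt_id (s : ℂ)).const_mul (2 * I * z))
        convert! this using 1
        simp
      convert! h2.cexp using 1
      ring
    exact h1.comp_ofReal
  have hint1 := (integrable_mul_gauss (2 * I * z)).const_mul (-2)
  have hint2 := ((integrable_gauss (2 * I * z)).integrableOn (s := Ioi 0)).const_mul (2 * I * z)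
  have ht : Tendsto (fun s : ℝ => cexp (-(s : ℂ) ^ 2 + 2 * I * z * s)) atTop (𝓝 0) := by
    rw [tendsto_zero_iff_norm_tendsto_zero]
    simp_rw [norm_gauss]
    refine Real.tendsto_exp_atBot.comp ?_
    have : ∀ s : ℝ, -s ^ 2 + (2 * I * z).re * s = s * ((2 * I * z).re - s) := fun s => by ring
    simp_rw [this]
    refine tendsto_id.atTop_mul_atBot₀ ?_
    exact tendsto_atBot_add_const_left _ _ tendsto_neg_atTop_atBot
  have key := integral_Ioi_of_hasDerivAt_of_tendsto' hd (hint1.add hint2) ht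
  rw [integral_add hint1 hint2, integral_const_mul, integral_const_mul] at key
  rw [w_eq_integral]
  have := sqrt_pi_ne
  simp at key
  have h2 : I * (Real.sqrt Real.pi : ℂ) * z * (2 / (Real.sqrt Real.pi : ℂ) *
      ∫ s in Ioi (0 : ℝ), cexp (-(s : ℂ) ^ 2 + 2 * I * z * s)) =
      2 * I * z * ∫ s in Ioi (0 : ℝ), cexp (-(s : ℂ) ^ 2 + 2 * I * z * s) := by
    generalize (∫ s in Ioi (0 : ℝ), cexp (-(s : ℂ) ^ 2 + 2 * I * z * s)) = J
    field_simp
  rw [h2]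
  linear_combination -key

lemma norm_integral_mul_gauss {z : ℂ} (hz : 0 ≤ z.im) :
    ‖2 * ∫ s in Ioi (0 : ℝ), (s : ℂ) * cexp (-(s : ℂ) ^ 2 + 2 * I * z * s)‖ ≤ 1 := by
  have h0 := integral_mul_gauss 0
  have h1 : ‖∫ s in Ioi (0 : ℝ), (s : ℂ) * cexp (-(s : ℂ) ^ 2 + 2 * I * z * s)‖ ≤
      ∫ s in Ioi (0 : ℝ), s * Real.exp (-s ^ 2) := by
    refine norm_integral_le_of_norm_le ?_ ?_
    · have := (integrable_mul_gauss 0).norm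
      refine this.congr ?_
      filter_upwards [ae_restrict_mem measurableSet_Ioi] with s hs
      have hs : 0 < s := hs
      rw [norm_mul, norm_gauss, norm_real, Real.norm_of_nonneg hs.le]
      simp
    · filter_upwards [ae_restrict_mem measurableSet_Ioi] with s hs
      have hs : 0 < s := hs
      rw [norm_mul, norm_gauss, norm_real, Real.norm_of_nonneg hs.le]
      gcongr
      have : (2 * I * z).re = - (2 * z.im) := by simp
      rw [this]
      nlinarith [mul_nonneg hz hs.le]
  -- The value of this real integral is read off from the integration by parts identity at `z = 0`.
  have h2 : 2 * ∫ s in Ioi (0 : ℝ), s * Real.exp (-s ^ 2) = 1 := by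
    have : ((2 * ∫ s in Ioi (0 : ℝ), s * Real.exp (-s ^ 2) : ℝ) : ℂ) = 1 := by
      rw [ofReal_mul]
      have h3 : ((∫ s in Ioi (0 : ℝ), s * Real.exp (-s ^ 2) : ℝ) : ℂ) =
        ∫ s in Ioi (0 : ℝ), ((s * Real.exp (-s ^ 2) : ℝ) : ℂ) := integral_ofReal.symm
      rw [h3]
      simpa using h0
    exact_mod_cast this
  rw [norm_mul]
  simp only [Complex.norm_ofNat]
  linarith

lemma norm_mul_w_le {z : ℂ} (hz : 0 ≤ z.im) : Real.sqrt Real.pi * ‖z * w z‖ ≤ 2 := by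
  have h := norm_integral_mul_gauss hz
  rw [integral_mul_gauss] at h
  have h2 : ‖I * (Real.sqrt Real.pi : ℂ) * z * w z‖ ≤ 2 := by
    calc _ = ‖(1 + I * (Real.sqrt Real.pi : ℂ) * z * w z) - 1‖ := by congr 1; ring
      _ ≤ 1 + 1 := (norm_sub_le _ _).trans (by simpa using h)
      _ = 2 := by norm_num
  rw [mul_assoc, norm_mul, norm_mul I] at h2
  rwa [norm_I, one_mul, norm_real, Real.norm_of_nonneg (Real.sqrt_nonneg _)] at h2

/-! ### Differentiability of `w` and the lower bound for its modulus. -/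

lemma hasDerivAt_w (z : ℂ) :
    HasDerivAt w (2 * I / (Real.sqrt Real.pi : ℂ) - 2 * z * w z) z := by
  have h := (hasDerivAt_integral_of_dominated_loc_of_deriv_le (μ := volume.restrict (Ioi (0 : ℝ)))
    (F := fun (z : ℂ) (s : ℝ) => cexp (-(s : ℂ) ^ 2 + 2 * I * z * s))
    (F' := fun (z : ℂ) (s : ℝ) => 2 * I * ((s : ℂ) * cexp (-(s : ℂ) ^ 2 + 2 * I * z * s)))
    (bound := fun s => 2 * Real.exp (-s ^ 2 + (2 * ‖z‖ + 3) * s))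
    (Metric.ball_mem_nhds z one_pos)
    (Eventually.of_forall fun z => by fun_prop) (integrable_gauss (2 * I * z)).integrableOn
    (by fun_prop) ?_ ((integrable_gauss_real _).integrableOn.const_mul 2) ?_).2
  · have h2 := h.const_mul (2 / (Real.sqrt Real.pi : ℂ))
    have h3 : w = fun z => (2 / (Real.sqrt Real.pi : ℂ)) *
      ∫ s in Ioi (0 : ℝ), cexp (-(s : ℂ) ^ 2 + 2 * I * z * s) := funext w_eq_integral
    rw [← h3, integral_const_mul] at h2
    convert! h2 using 1
    have h4 := integral_mul_gauss z
    have := sqrt_pi_ne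
    generalize (∫ s in Ioi (0 : ℝ), (s : ℂ) * cexp (-(s : ℂ) ^ 2 + 2 * I * z * s)) = J at *
    field_simp
    linear_combination -I * h4 - (Real.sqrt Real.pi : ℂ) * z * w z * I_sq
  · filter_upwards [ae_restrict_mem measurableSet_Ioi] with s hs x hx
    have hs : 0 < s := hs
    have hx : ‖x‖ ≤ ‖z‖ + 1 := by
      have : dist x z < 1 := hx
      rw [dist_eq_norm] at this
      have := norm_le_norm_add_norm_sub' x z
      linarith
    have h1 : (2 * I * x).re ≤ 2 * ‖z‖ + 2 := by
      refine (re_le_norm _).trans ?_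
      simp; linarith
    rw [norm_mul, norm_mul (s : ℂ), norm_gauss, norm_real, Real.norm_of_nonneg hs.le]
    simp only [norm_mul, Complex.norm_ofNat, norm_I, mul_one]
    rw [show -s ^ 2 + (2 * ‖z‖ + 3) * s = s + (-s ^ 2 + (2 * ‖z‖ + 2) * s) by ring, Real.exp_add s]
    gcongr ?_ * (?_ * Real.exp (_ + ?_ * _))
    linarith [Real.add_one_le_exp s]
  · refine Eventually.of_forall fun s x _ => ?_
    have h2 : HasDerivAt (fun x : ℂ => -(s : ℂ) ^ 2 + 2 * I * x * s) (2 * I * s) x := by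
      have := (((hasDerivAt_id x).const_mul (2 * I)).mul_const (s : ℂ)).const_add (-(s : ℂ) ^ 2)
      simpa using this
    convert! h2.cexp using 1
    ring

lemma continuous_w : Continuous w :=
  continuous_iff_continuousAt.2 fun z => (hasDerivAt_w z).continuousAt

lemma w_zero : w 0 = 1 := by
  have := w_add_w_neg 0
  simp at this
  linear_combination this / 2

lemma w_re_ofReal (x : ℝ) : (w x).re = Real.exp (-x ^ 2) := by
  have h := w_add_w_neg x
  have h2 := conj_w x
  rw [conj_ofReal] at h2
  rw [← h2] at h
  have h3 := congrArg re h
  rw [← ofReal_pow, ← ofReal_neg (x ^ 2), ← ofReal_exp] at h3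
  simp [-ofReal_exp, -ofReal_neg, -ofReal_pow] at h3
  linarith

/-- With `u = e^{x²} Im w`, one has `u' = (2/√π) e^{x²}` and `u 0 = 0`, so `u ≥ 0` for `x ≥ 0`. Then
`√π x u - e^{x²}` has derivative `√π u ≥ 0` and starts at `-1`. -/
lemma w_im_ofReal_lower {x : ℝ} (hx : 0 ≤ x) :
    1 - Real.exp (-x ^ 2) ≤ Real.sqrt Real.pi * x * (w x).im := by
  have hv : ∀ x : ℝ, HasDerivAt (fun x : ℝ => (w x).im)
      (2 / Real.sqrt Real.pi - 2 * x * (w x).im) x := by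
    intro x
    have h1 := (hasDerivAt_w x).comp_ofReal
    have h2 := imCLM.hasFDerivAt.comp_hasDerivAt x h1
    convert! h2 using 1
    rw [show 2 * I / (Real.sqrt Real.pi : ℂ) - 2 * x * w x =
      ((2 / Real.sqrt Real.pi : ℝ) : ℂ) * I - ((2 * x : ℝ) : ℂ) * w x by push_cast; ring]
    simp [-ofReal_mul, -ofReal_div]
  have he : ∀ x : ℝ, HasDerivAt (fun x : ℝ => Real.exp (x ^ 2)) (2 * x * Real.exp (x ^ 2)) x := by
    intro x
    convert! (hasDerivAt_pow 2 x).exp using 1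
    simp; ring
  set u : ℝ → ℝ := fun x => Real.exp (x ^ 2) * (w x).im with hu
  have hud : ∀ x : ℝ, HasDerivAt u (2 / Real.sqrt Real.pi * Real.exp (x ^ 2)) x := by
    intro x
    convert! (he x).mul (hv x) using 1
    ring
  have hu0 : u 0 = 0 := by simp [hu, w_zero]
  have hum : Monotone u := monotone_of_hasDerivAt_nonneg hud fun x => by positivity
  have hBd : ∀ x : ℝ, HasDerivAt (fun x => Real.sqrt Real.pi * (x * u x) - Real.exp (x ^ 2))
      (Real.sqrt Real.pi * u x) x := by
    intro x
    have h1 := (((hasDerivAt_id x).mul (hud x)).const_mul (Real.sqrt Real.pi)).sub (he x)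
    convert! h1 using 1
    have := sqrt_pi_pos
    simp
    field_simp
    ring
  have hB : MonotoneOn (fun x => Real.sqrt Real.pi * (x * u x) - Real.exp (x ^ 2)) (Ici 0) := by
    refine monotoneOn_of_deriv_nonneg (convex_Ici 0)
      (fun x _ => (hBd x).continuousAt.continuousWithinAt)
      (fun x _ => (hBd x).differentiableAt.differentiableWithinAt) ?_
    intro x hx
    rw [interior_Ici] at hx
    rw [(hBd x).deriv]
    exact mul_nonneg (Real.sqrt_nonneg _) (hu0 ▸ hum (le_of_lt hx))
  have h3 := hB (mem_Ici.2 le_rfl) (mem_Ici.2 hx) hx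
  simp only [zero_mul, mul_zero] at h3
  have h4 : Real.exp (x ^ 2) * Real.exp (-x ^ 2) = 1 := by rw [← Real.exp_add]; simp
  have h5 : (0 : ℝ) < Real.exp (x ^ 2) := Real.exp_pos _
  have h6 : Real.exp (x ^ 2) - 1 ≤ Real.exp (x ^ 2) * (Real.sqrt Real.pi * x * (w x).im) := by
    have : Real.exp ((0 : ℝ) ^ 2) = 1 := by simp
    rw [this] at h3
    have h7 : √Real.pi * (x * u x) = Real.exp (x ^ 2) * (Real.sqrt Real.pi * x * (w x).im) := by
      simp only [hu]; ring
    linarith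
  have h8 : Real.exp (x ^ 2) * (1 - Real.exp (-x ^ 2)) ≤
      Real.exp (x ^ 2) * (Real.sqrt Real.pi * x * (w x).im) := by
    rw [mul_sub, h4]; linarith
  exact le_of_mul_le_mul_left h8 h5

/-- For `x ≥ 0` the real part is `Re w + √π x Im w`, with `Re w = e^{-x²}` and the other summand at
least `1 - e^{-x²}`. Conjugation symmetry covers `x < 0`. This is the boundary input for
Phragmén–Lindelöf. -/
lemma one_le_re_ofReal (x : ℝ) : 1 ≤ ((1 - I * (Real.sqrt Real.pi : ℂ) * x) * w x).re := by
  have main : ∀ x : ℝ, 0 ≤ x → 1 ≤ ((1 - I * (Real.sqrt Real.pi : ℂ) * x) * w x).re := by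
    intro x hx
    have h1 := w_im_ofReal_lower hx
    have h2 := w_re_ofReal x
    have : ((1 - I * (Real.sqrt Real.pi : ℂ) * x) * w x).re =
        (w x).re + Real.sqrt Real.pi * x * (w x).im := by
      simp
    linarith
  rcases le_total 0 x with hx | hx
  · exact main x hx
  · have h := main (-x) (by linarith)
    have h2 := conj_w x
    rw [conj_ofReal] at h2
    rw [ofReal_neg, ← h2] at h
    simpa using h

/-- In the closed upper half-plane `Re ((1 - i√π z) w z) ≥ 1`, by Phragmén–Lindelöf. -/
lemma one_le_re {z : ℂ} (hz : 0 ≤ z.im) :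
    1 ≤ ((1 - I * (Real.sqrt Real.pi : ℂ) * z) * w z).re := by
  -- The rotation `u ↦ iu` maps the right half-plane to the upper one, and exponentiating turns a
  -- lower bound on a real part into an upper bound on a modulus. The a priori bound `e³` comes from
  -- `‖w‖ + √π ‖z w‖ ≤ 1 + 2`.
  set g : ℂ → ℂ := fun u => cexp (-((1 - I * (Real.sqrt Real.pi : ℂ) * (I * u)) * w (I * u))) with hg
  have hgb : ∀ u : ℂ, 0 ≤ u.re → ‖g u‖ ≤ Real.exp 3 := by
    intro u hu
    have him : 0 ≤ (I * u).im := by simpa using hu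
    rw [hg, Complex.norm_exp]
    gcongr
    refine (re_le_norm _).trans ?_
    rw [norm_neg, sub_mul, one_mul]
    refine (norm_sub_le _ _).trans ?_
    have h1 := norm_w_le_one him
    have h2 := norm_mul_w_le him
    have h3 : ‖I * (Real.sqrt Real.pi : ℂ) * (I * u) * w (I * u)‖ =
        Real.sqrt Real.pi * ‖(I * u) * w (I * u)‖ := by
      rw [mul_assoc, norm_mul, norm_mul, norm_I, one_mul, norm_real,
        Real.norm_of_nonneg (Real.sqrt_nonneg _)]
    linarith
  have hd : Differentiable ℂ g := by
    have : Differentiable ℂ w := fun z => (hasDerivAt_w z).differentiableAt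
    exact Differentiable.cexp (Differentiable.neg (((differentiable_const _).sub
      ((differentiable_const _).mul ((differentiable_const _).mul differentiable_id))).mul
      (this.comp ((differentiable_const _).mul differentiable_id))))
  have key := PhragmenLindelof.right_half_plane_of_bounded_on_real (f := g) (C := Real.exp (-1))
    (z := -I * z) hd.diffContOnCl ?_ ?_ ?_ (by simpa using hz)
  · rw [hg, Complex.norm_exp] at key
    have h := Real.exp_le_exp.1 key
    have h2 : I * (-I * z) = z := by
      linear_combination (-z) * I_sq
    rw [h2, neg_re] at h
    linarith
  · refine ⟨1, by norm_num, 0, ?_⟩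
    refine Asymptotics.IsBigO.of_bound (Real.exp 3) ?_
    have : ∀ᶠ u in Bornology.cobounded ℂ ⊓ 𝓟 {u : ℂ | 0 < u.re}, u ∈ {u : ℂ | 0 < u.re} :=
      eventually_inf_principal.2 (Eventually.of_forall fun _ h => h)
    filter_upwards [this] with u hu
    simpa using hgb u (le_of_lt hu)
  · refine ⟨Real.exp 3, ?_⟩
    rw [eventually_map]
    filter_upwards [eventually_ge_atTop 0] with x hx
    exact hgb x (by simpa using hx)
  · intro x
    rw [hg, Complex.norm_exp]
    gcongr
    have h := one_le_re_ofReal (-x)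
    have h2 : I * ((x : ℂ) * I) = ((-x : ℝ) : ℂ) := by
      push_cast
      linear_combination (x : ℂ) * I_sq
    rw [h2, neg_re]
    linarith

lemma norm_w_lower {z : ℂ} (hz : 0 ≤ z.im) : 1 ≤ (1 + Real.sqrt Real.pi * ‖z‖) * ‖w z‖ := by
  have h1 := (one_le_re hz).trans (re_le_norm _)
  rw [norm_mul] at h1
  refine h1.trans ?_
  gcongr
  refine (norm_sub_le _ _).trans ?_
  rw [norm_one, norm_mul, norm_mul, norm_I, one_mul, norm_real,
    Real.norm_of_nonneg (Real.sqrt_nonneg _)]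

lemma w_ne_zero {z : ℂ} (hz : 0 ≤ z.im) : w z ≠ 0 := by
  intro h
  have := norm_w_lower hz
  rw [h] at this
  norm_num at this

/-! ### Poisson summation for the nodal sums. -/

/-- The functional equation of the Jacobi theta series with parameter `h²/π`, before integration
over `s`: the left side integrates to the Cauchy kernels at the nodes, the right side to shifted
copies of `w`. -/
lemma poisson_gauss {h a : ℝ} (hh : 0 < h) (ha : a * h = Real.pi) (δ s : ℝ) (z : ℂ) :
    ∑' k : ℤ, (h : ℂ) * (cexp (-((((k : ℝ) + δ) * h : ℝ) : ℂ) ^ 2) *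
        cexp (2 * I * (z - (((k : ℝ) + δ) * h : ℝ)) * s)) =
      ∑' n : ℤ, (Real.sqrt Real.pi : ℂ) * cexp (2 * Real.pi * I * δ * n) *
        (cexp (-(a * n : ℂ) ^ 2) * cexp (-(s : ℂ) ^ 2 + 2 * I * (z + I * (a * n)) * s)) := by
  have hpi : (Real.pi : ℂ) ≠ 0 := by exact_mod_cast Real.pi_ne_zero
  have hhc : (h : ℂ) ≠ 0 := by exact_mod_cast hh.ne'
  have hac : (a : ℂ) * h = Real.pi := by exact_mod_cast ha
  have key := Complex.tsum_exp_neg_quadratic (a := ((h ^ 2 / Real.pi : ℝ) : ℂ))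
    (by rw [ofReal_re]; have := Real.pi_pos; positivity) (-(δ * h ^ 2 + I * h * s) / Real.pi)
  have hroot : ((h ^ 2 / Real.pi : ℝ) : ℂ) ^ (1 / 2 : ℂ) = h / (Real.sqrt Real.pi : ℂ) := by
    rw [show (1 / 2 : ℂ) = ((1 / 2 : ℝ) : ℂ) by push_cast; rfl,
      ← ofReal_cpow (by have := Real.pi_pos; positivity), ← Real.sqrt_eq_rpow,
      Real.sqrt_div (sq_nonneg h), Real.sqrt_sq hh.le]
    push_cast; rfl
  rw [hroot] at key
  have hL : ∀ k : ℤ, (h : ℂ) * (cexp (-((((k : ℝ) + δ) * h : ℝ) : ℂ) ^ 2) *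
        cexp (2 * I * (z - (((k : ℝ) + δ) * h : ℝ)) * s)) =
      (h * cexp (2 * I * z * s - δ ^ 2 * h ^ 2 - 2 * I * δ * h * s)) *
      cexp (-Real.pi * ((h ^ 2 / Real.pi : ℝ) : ℂ) * k ^ 2 +
        2 * Real.pi * (-(δ * h ^ 2 + I * h * s) / Real.pi) * k) := by
    intro k
    rw [← Complex.exp_add, mul_assoc (h : ℂ), ← Complex.exp_add]
    congr 2
    push_cast
    field_simp
    ring
  have hR : ∀ n : ℤ, (Real.sqrt Real.pi : ℂ) * cexp (2 * Real.pi * I * δ * n) *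
        (cexp (-(a * n : ℂ) ^ 2) * cexp (-(s : ℂ) ^ 2 + 2 * I * (z + I * (a * n)) * s)) =
      (h * cexp (2 * I * z * s - δ ^ 2 * h ^ 2 - 2 * I * δ * h * s)) *
        (1 / (h / (Real.sqrt Real.pi : ℂ)) * cexp (-Real.pi / ((h ^ 2 / Real.pi : ℝ) : ℂ) *
        (n + I * (-(δ * h ^ 2 + I * h * s) / Real.pi)) ^ 2)) := by
    intro n
    have e1 : ∀ A B C : ℂ, (h * A) * (1 / (h / C) * B) = C * (A * B) := by
      intro A B C; field_simp
    rw [e1, mul_assoc, ← Complex.exp_add, ← Complex.exp_add, ← Complex.exp_add]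
    congr 2
    have h2 : -(Real.pi : ℂ) / ((h ^ 2 / Real.pi : ℝ) : ℂ) *
        (n + I * (-(δ * h ^ 2 + I * h * s) / Real.pi)) ^ 2 =
        -(a * n + s - I * δ * h) ^ 2 := by
      have : (a : ℂ) = Real.pi / h := by rw [← hac]; field_simp
      rw [this]
      push_cast
      field_simp
      ring_nf
      simp only [I_sq, I_pow_four, I_pow_three]
      ring
    rw [h2, ← hac]
    ring_nf
    simp only [I_sq]
    ring
  rw [tsum_congr hL, tsum_congr hR, tsum_mul_left, tsum_mul_left, key, tsum_mul_left]

lemma summable_gauss_nodes {h : ℝ} (hh : 0 < h) (δ : ℝ) :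
    Summable (fun k : ℤ => Real.exp (-(((k : ℝ) + δ) * h) ^ 2)) := by
  have hpi := Real.pi_pos
  have := summable_pow_mul_jacobiTheta₂_term_bound (|δ| * h ^ 2 / Real.pi)
    (T := h ^ 2 / Real.pi) (by positivity) 0
  refine Summable.of_nonneg_of_le (fun _ => (Real.exp_pos _).le) (fun k => ?_) this
  rw [pow_zero, one_mul]
  gcongr
  have h1 : -Real.pi * (h ^ 2 / Real.pi * (k : ℝ) ^ 2 - 2 * (|δ| * h ^ 2 / Real.pi) * ((|k| : ℤ) : ℝ))
      = -(h ^ 2 * (k : ℝ) ^ 2) + 2 * (|δ| * ((|k| : ℤ) : ℝ)) * h ^ 2 := by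
    field_simp
    ring
  have h2 : -(δ * k) ≤ |δ| * ((|k| : ℤ) : ℝ) := by
    rw [Int.cast_abs, ← abs_mul]; exact neg_le_abs _
  push_cast at h1 h2 ⊢
  rw [h1]
  nlinarith [mul_le_mul_of_nonneg_right h2 (sq_nonneg h), mul_nonneg (sq_nonneg δ) (sq_nonneg h)]

lemma integral_gauss_shift_le (b : ℝ) :
    ∫ s in Ioi (0 : ℝ), Real.exp (-s ^ 2 + b * s) ≤ Real.sqrt Real.pi * Real.exp (b ^ 2 / 4) := by
  calc ∫ s in Ioi (0 : ℝ), Real.exp (-s ^ 2 + b * s)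
      ≤ ∫ s : ℝ, Real.exp (-s ^ 2 + b * s) :=
        setIntegral_le_integral (integrable_gauss_real b)
          (Eventually.of_forall fun _ => (Real.exp_pos _).le)
    _ = ∫ s : ℝ, Real.exp (b ^ 2 / 4) * Real.exp (-1 * (s - b / 2) ^ 2) := by
        congr 1; ext s; rw [← Real.exp_add]; congr 1; ring
    _ = _ := by
        rw [integral_const_mul, integral_sub_right_eq_self (fun s : ℝ => Real.exp (-1 * s ^ 2)),
          integral_gaussian]
        simp [mul_comm]

lemma integral_gauss_neg_le {b : ℝ} (hb : b ≤ 0) :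
    ∫ s in Ioi (0 : ℝ), Real.exp (-s ^ 2 + b * s) ≤ Real.sqrt Real.pi := by
  calc ∫ s in Ioi (0 : ℝ), Real.exp (-s ^ 2 + b * s)
      ≤ ∫ s in Ioi (0 : ℝ), Real.exp (-s ^ 2 + 0 * s) := by
        refine setIntegral_mono_on (integrable_gauss_real b).integrableOn
          (integrable_gauss_real 0).integrableOn measurableSet_Ioi fun s hs => ?_
        have hs : 0 < s := hs
        gcongr
    _ ≤ _ := by
        refine (integral_gauss_shift_le 0).trans ?_
        simp

/-- For `n ≥ 0` the factor `e^{-(an)²}` suffices. For negative indices completing the square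
produces `e^{(y-a|n|)²}`, which cancels that factor and leaves `e^{y² - 2ya|n|}`; convergence then
rests on `y > 0`, so real `z` are treated later by a limit. -/
lemma summable_shifted {a y : ℝ} (ha : 0 < a) (hy : 0 < y) :
    Summable (fun n : ℤ => Real.exp (-(a * n) ^ 2) *
      ∫ s in Ioi (0 : ℝ), Real.exp (-s ^ 2 + -(2 * (y + a * n)) * s)) := by
  have hnn : ∀ b : ℝ, 0 ≤ ∫ s in Ioi (0 : ℝ), Real.exp (-s ^ 2 + b * s) :=
    fun b => integral_nonneg fun _ => (Real.exp_pos _).le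
  refine Summable.of_nat_of_neg ?_ ?_
  · have hg : Summable (fun n : ℕ => Real.sqrt Real.pi * Real.exp (-a ^ 2) ^ n) :=
      (summable_geometric_of_lt_one (Real.exp_pos _).le
        (Real.exp_lt_one_iff.2 (by nlinarith))).mul_left _
    refine Summable.of_nonneg_of_le (fun n => mul_nonneg (Real.exp_pos _).le (hnn _))
      (fun n => ?_) hg
    rw [mul_comm, ← Real.exp_nat_mul]
    gcongr
    · exact integral_gauss_neg_le (by simp; positivity)
    · have : (n : ℝ) ≤ (n : ℝ) ^ 2 := by
        exact_mod_cast Nat.le_self_pow two_ne_zero n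
      push_cast
      nlinarith [mul_le_mul_of_nonneg_right this (sq_nonneg a)]
  · have hg : Summable (fun n : ℕ => Real.sqrt Real.pi * Real.exp (y ^ 2) *
        Real.exp (-(2 * y * a)) ^ n) :=
      (summable_geometric_of_lt_one (Real.exp_pos _).le
        (Real.exp_lt_one_iff.2 (by have := mul_pos hy ha; linarith))).mul_left _
    refine Summable.of_nonneg_of_le (fun n => mul_nonneg (Real.exp_pos _).le (hnn _))
      (fun n => ?_) hg
    refine (mul_le_mul_of_nonneg_left (integral_gauss_shift_le _) (Real.exp_pos _).le).trans
      (le_of_eq ?_)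
    rw [← Real.exp_nat_mul, mul_left_comm, mul_assoc, ← Real.exp_add, ← Real.exp_add]
    congr 2
    push_cast
    ring

/-- The nodal sum and the sum of shifted copies of `w` agree. -/
lemma exists_hasSum_nodes {h a : ℝ} (hh : 0 < h) (ha : a * h = Real.pi) (δ : ℝ) {z : ℂ}
    (hz : 0 < z.im) :
    ∃ S : ℂ, HasSum (fun k : ℤ => I * h / Real.pi * (cexp (-((((k : ℝ) + δ) * h : ℝ) : ℂ) ^ 2) /
        (z - (((k : ℝ) + δ) * h : ℝ)))) S ∧
      HasSum (fun n : ℤ => cexp (2 * Real.pi * I * δ * n) *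
        (cexp (-(a * n : ℂ) ^ 2) * w (z + I * (a * n)))) S := by
  have hpi : (Real.pi : ℂ) ≠ 0 := by exact_mod_cast Real.pi_ne_zero
  have hapos : 0 < a := pos_of_mul_pos_left (ha ▸ Real.pi_pos) hh.le
  have hre : ∀ k : ℤ, (2 * I * (z - (((k : ℝ) + δ) * h : ℝ))).re = -(2 * z.im) := by
    intro k; simp
  have hneg : ∀ k : ℤ, (2 * I * (z - (((k : ℝ) + δ) * h : ℝ))).re < 0 := by
    intro k; rw [hre]; linarith
  set μ := volume.restrict (Ioi (0 : ℝ)) with hμ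
  let F : ℤ → ℝ → ℂ := fun k s => (h : ℂ) * (cexp (-((((k : ℝ) + δ) * h : ℝ) : ℂ) ^ 2) *
        cexp (2 * I * (z - (((k : ℝ) + δ) * h : ℝ)) * s))
  let G : ℤ → ℝ → ℂ := fun n s => (Real.sqrt Real.pi : ℂ) * cexp (2 * Real.pi * I * δ * n) *
        (cexp (-(a * n : ℂ) ^ 2) * cexp (-(s : ℂ) ^ 2 + 2 * I * (z + I * (a * n)) * s))
  have hFG : ∀ s, ∑' k, F k s = ∑' n, G n s := fun s => poisson_gauss hh ha δ s z
  -- Both series in `s` are integrated termwise; they have the same sum function, hence the same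
  -- integral.
  have hF := hasSum_integral_of_summable_integral_norm (μ := μ) (F := F) ?_ ?_
  have hG := hasSum_integral_of_summable_integral_norm (μ := μ) (F := G) ?_ ?_
  · simp_rw [hFG] at hF
    refine ⟨2 / Real.pi * ∫ s, ∑' n, G n s ∂μ, ?_, ?_⟩
    · convert! hF.mul_left (2 / (Real.pi : ℂ)) using 1
      ext k
      have h1 : z - (((k : ℝ) + δ) * h : ℝ) ≠ 0 := by
        intro h0
        have := hneg k
        rw [h0] at this
        simp at this
      have h2 : ∫ s, F k s ∂μ = (h : ℂ) * (cexp (-((((k : ℝ) + δ) * h : ℝ) : ℂ) ^ 2) *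
          (-1 / (2 * I * (z - (((k : ℝ) + δ) * h : ℝ))))) := by
        simp only [F]
        rw [integral_const_mul, integral_const_mul, hμ, integral_exp_mul_complex_Ioi (hneg k)]
        simp
      rw [h2]
      generalize z - ((((k : ℝ) + δ) * h : ℝ) : ℂ) = u at h1
      have := I_ne_zero
      field_simp
      rw [I_sq]
      ring
    · convert! hG.mul_left (2 / (Real.pi : ℂ)) using 1
      ext n
      simp only [G]
      rw [integral_const_mul, integral_const_mul, w_eq_integral]
      have h1 := sqrt_pi_ne
      have h2 : (Real.pi : ℂ) = (Real.sqrt Real.pi : ℂ) ^ 2 := by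
        exact_mod_cast sq_sqrt_pi.symm
      rw [hμ]
      generalize (∫ s in Ioi (0 : ℝ), cexp (-(s : ℂ) ^ 2 + 2 * I * (z + I * (a * n)) * s)) = J
      generalize hE : cexp (2 * Real.pi * I * δ * n) = E
      rw [h2]
      field_simp
  · intro n
    exact ((integrable_gauss _).integrableOn.const_mul _).const_mul _
  · have h1 : ∀ n : ℤ, ∫ s, ‖G n s‖ ∂μ = Real.sqrt Real.pi * (Real.exp (-(a * n) ^ 2) *
      ∫ s in Ioi (0 : ℝ), Real.exp (-s ^ 2 + -(2 * (z.im + a * n)) * s)) := by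
      intro n
      have h2 : ∀ s : ℝ, ‖G n s‖ = Real.sqrt Real.pi * (Real.exp (-(a * n) ^ 2) *
          Real.exp (-s ^ 2 + -(2 * (z.im + a * n)) * s)) := by
        intro s
        simp only [G]
        rw [norm_mul, norm_mul, norm_mul, norm_gauss, norm_real,
          Real.norm_of_nonneg (Real.sqrt_nonneg _)]
        have e1 : ‖cexp (2 * Real.pi * I * δ * n)‖ = 1 := by
          rw [show (2 * Real.pi * I * δ * n : ℂ) = ((2 * Real.pi * δ * n : ℝ) : ℂ) * I by
            push_cast; ring, norm_exp_ofReal_mul_I]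
        have e2 : ‖cexp (-(a * n : ℂ) ^ 2)‖ = Real.exp (-(a * n) ^ 2) := by
          rw [show (-(a * n : ℂ) ^ 2) = ((-(a * n) ^ 2 : ℝ) : ℂ) by push_cast; ring,
            ← ofReal_exp, norm_real, Real.norm_of_nonneg (Real.exp_pos _).le]
        have e3 : (2 * I * (z + I * (a * n))).re = -(2 * (z.im + a * n)) := by
          simp
        rw [e1, e2, e3, mul_one]
      simp_rw [h2]
      rw [integral_const_mul, integral_const_mul]
    simp_rw [h1]
    exact (summable_shifted hapos hz).mul_left _
  · intro k
    exact ((integrableOn_exp_mul_complex_Ioi (hneg k) 0).const_mul _).const_mul _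
  · have h1 : ∀ k : ℤ, ∫ s, ‖F k s‖ ∂μ = (h * ∫ s in Ioi (0 : ℝ), Real.exp (-(2 * z.im) * s)) *
        Real.exp (-(((k : ℝ) + δ) * h) ^ 2) := by
      intro k
      have h2 : ∀ s : ℝ, ‖F k s‖ = h * Real.exp (-(((k : ℝ) + δ) * h) ^ 2) *
          Real.exp (-(2 * z.im) * s) := by
        intro s
        simp only [F]
        have e2 : ‖cexp (-((((k : ℝ) + δ) * h : ℝ) : ℂ) ^ 2)‖ =
            Real.exp (-(((k : ℝ) + δ) * h) ^ 2) := by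
          rw [← ofReal_pow, ← ofReal_neg, ← ofReal_exp, norm_real,
            Real.norm_of_nonneg (Real.exp_pos _).le]
        rw [norm_mul, norm_mul, e2, Complex.norm_exp, norm_real, Real.norm_of_nonneg hh.le,
          re_mul_ofReal, hre, mul_assoc]
      simp_rw [h2]
      rw [integral_const_mul]
      ring
    simp_rw [h1]
    exact (summable_gauss_nodes hh δ).mul_left _

/-! ### The discretization error as a series in paired shifts. -/

lemma hasSum_shifted_add {a δ : ℝ} {σ z S : ℂ} (hσ : cexp (2 * Real.pi * I * δ) = σ)
    (hσ2 : σ * σ = 1)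
    (hS : HasSum (fun n : ℤ => cexp (2 * Real.pi * I * δ * n) *
        (cexp (-(a * n : ℂ) ^ 2) * w (z + I * (a * n)))) S) :
    HasSum (fun m : ℕ => σ ^ (m + 1) * (cexp (-(a * (m + 1) : ℂ) ^ 2) *
      (w (z + I * (a * (m + 1))) + w (z - I * (a * (m + 1)))))) (S - w z) := by
  -- Folding counts the index `0` twice, for a total of `S + w z`; dropping the folded term `2 w z`
  -- leaves `S - w z`.
  have h1 := hS.nat_add_neg
  have h2 := (hasSum_nat_add_iff' 1).2 h1
  convert! h2 using 1
  · ext m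
    have e1 : cexp (2 * Real.pi * I * δ * (((m + 1 : ℕ) : ℤ) : ℂ)) = σ ^ (m + 1) := by
      rw [← hσ, ← Complex.exp_nat_mul]; congr 1; push_cast; ring
    have e2 : cexp (2 * Real.pi * I * δ * ((-((m + 1 : ℕ) : ℤ) : ℤ) : ℂ)) = σ ^ (m + 1) := by
      have h3 : cexp (2 * Real.pi * I * δ * ((-((m + 1 : ℕ) : ℤ) : ℤ) : ℂ)) * σ ^ (m + 1) = 1 := by
        rw [← e1, ← Complex.exp_add, ← Complex.exp_zero]; congr 1; push_cast; ring
      have h4 : σ ^ (m + 1) * σ ^ (m + 1) = 1 := by rw [← mul_pow, hσ2, one_pow]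
      linear_combination σ ^ (m + 1) * h3 -
        (cexp (2 * Real.pi * I * δ * ((-((m + 1 : ℕ) : ℤ) : ℤ) : ℂ))) * h4
    rw [e1, e2]
    push_cast
    rw [show -((a : ℂ) * -((m : ℂ) + 1)) ^ 2 = -((a : ℂ) * (m + 1)) ^ 2 by ring,
      show z + I * (a * -((m : ℂ) + 1)) = z - I * (a * (m + 1)) by ring]
    ring
  · simp

/-- Reflection at `z - ib`, using `e^{-b²} e^{-(z-ib)²} = e^{-z²} e^{2ibz}`. -/
lemma w_sub_shift (z : ℂ) (b : ℝ) :
    cexp (-(b : ℂ) ^ 2) * w (z - I * b) =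
      2 * (cexp (-z ^ 2) * cexp (2 * I * b * z)) - cexp (-(b : ℂ) ^ 2) * w (-z + I * b) := by
  have h := w_add_w_neg (z - I * b)
  rw [show -(z - I * b) = -z + I * b by ring] at h
  have h2 : cexp (-z ^ 2) * cexp (2 * I * b * z) =
      cexp (-(b : ℂ) ^ 2) * cexp (-(z - I * b) ^ 2) := by
    rw [← Complex.exp_add, ← Complex.exp_add]
    congr 1
    linear_combination (b : ℂ) ^ 2 * I_sq
  rw [h2]
  linear_combination cexp (-(b : ℂ) ^ 2) * h

/-- The reflection terms form a geometric series of ratio `σq`, `q = e^{2iaz}`, with `|q| < 1` above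
the axis. As `σ² = 1`, its sum `2e^{-z²} σq/(1 - σq)` equals `-2e^{-z²}/(1 - σq⁻¹)`, minus the
correction term of the modified rule. -/
lemma hasSum_shifted_sub {a δ : ℝ} {σ z S : ℂ} (ha : 0 < a) (hz : 0 < z.im)
    (hσ : cexp (2 * Real.pi * I * δ) = σ) (hσ2 : σ * σ = 1)
    (hS : HasSum (fun n : ℤ => cexp (2 * Real.pi * I * δ * n) *
        (cexp (-(a * n : ℂ) ^ 2) * w (z + I * (a * n)))) S) :
    HasSum (fun m : ℕ => σ ^ (m + 1) * (cexp (-(a * (m + 1) : ℂ) ^ 2) *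
      (w (z + I * (a * (m + 1))) - w (-z + I * (a * (m + 1))))))
      (S - w z + 2 * cexp (-z ^ 2) / (1 - σ * cexp (-(2 * I * a * z)))) := by
  set q := cexp (2 * I * a * z) with hq
  have hσn : ‖σ‖ = 1 := by
    have : ‖σ‖ * ‖σ‖ = 1 := by rw [← norm_mul, hσ2, norm_one]
    nlinarith [norm_nonneg σ]
  have hqn : ‖σ * q‖ < 1 := by
    rw [norm_mul, hσn, one_mul, hq, Complex.norm_exp]
    refine Real.exp_lt_one_iff.2 ?_
    have := mul_pos ha hz
    simp
    linarith
  have hg := ((hasSum_geometric_of_norm_lt_one hqn).mul_left (2 * cexp (-z ^ 2) * (σ * q)))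
  have h := (hasSum_shifted_add hσ hσ2 hS).sub hg
  convert! h using 1
  · ext m
    have e := w_sub_shift z (a * (m + 1))
    have e2 : cexp (2 * I * ((a * (m + 1) : ℝ) : ℂ) * z) = q ^ (m + 1) := by
      rw [hq, ← Complex.exp_nat_mul]; congr 1; push_cast; ring
    rw [e2] at e
    push_cast at e
    rw [mul_pow σ q]
    linear_combination -σ ^ (m + 1) * e
  · have h1 : cexp (-(2 * I * a * z)) = q⁻¹ := by rw [Complex.exp_neg]
    have h0 : q ≠ 0 := Complex.exp_ne_zero _
    have h3 : 1 - σ * q ≠ 0 := by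
      intro h
      have : σ * q = 1 := by linear_combination -h
      rw [this, norm_one] at hqn
      exact lt_irrefl _ hqn
    have h4 : 1 - σ * q⁻¹ ≠ 0 := by
      intro h
      apply h3
      have : q = σ := by
        field_simp at h
        linear_combination h
      rw [this, hσ2, sub_self]
    rw [h1, sub_eq_add_neg (S - w z)]
    congr 1
    rw [div_eq_iff h4]
    field_simp
    linear_combination -hσ2

/-! ### Estimates for the terms of the discretization error. -/

lemma norm_cexp_neg_sq (b : ℝ) : ‖cexp (-(b : ℂ) ^ 2)‖ = Real.exp (-b ^ 2) := by
  rw [← ofReal_pow, ← ofReal_neg, ← ofReal_exp, norm_real, Real.norm_of_nonneg (Real.exp_pos _).le]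

/-- Transfers the decay of `w` at a shifted point `v` to the weight `‖z‖`, the shift costing `√π b`.
-/
lemma mul_norm_w_le_of_norm_le {z v : ℂ} {b : ℝ} (hv : 0 ≤ v.im) (h : ‖z‖ ≤ ‖v‖ + b) (hb : 0 ≤ b) :
    Real.sqrt Real.pi * ‖z‖ * ‖w v‖ ≤ 2 + Real.sqrt Real.pi * b := by
  have h1 := norm_mul_w_le hv
  rw [norm_mul] at h1
  have h2 := norm_w_le_one hv
  have := sqrt_pi_pos
  calc _ ≤ Real.sqrt Real.pi * (‖v‖ + b) * ‖w v‖ := by gcongr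
    _ = Real.sqrt Real.pi * (‖v‖ * ‖w v‖) + Real.sqrt Real.pi * b * ‖w v‖ := by ring
    _ ≤ 2 + Real.sqrt Real.pi * b * 1 := by gcongr
    _ = _ := by ring

lemma norm_le_norm_add_shift (z : ℂ) {b : ℝ} (hb : 0 ≤ b) : ‖z‖ ≤ ‖z + I * b‖ + b := by
  have := norm_sub_le (z + I * b) (I * b)
  rw [add_sub_cancel_right, norm_mul, norm_I, one_mul, norm_real, Real.norm_of_nonneg hb] at this
  exact this

lemma norm_le_norm_sub_shift (z : ℂ) {b : ℝ} (hb : 0 ≤ b) : ‖z‖ ≤ ‖z - I * b‖ + b := by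
  have := norm_add_le (z - I * b) (I * b)
  rw [sub_add_cancel, norm_mul, norm_I, one_mul, norm_real, Real.norm_of_nonneg hb] at this
  exact this

lemma norm_le_norm_neg_add_shift (z : ℂ) {b : ℝ} (hb : 0 ≤ b) : ‖z‖ ≤ ‖-z + I * b‖ + b := by
  have := norm_le_norm_add_shift (-z) hb
  rwa [norm_neg] at this

lemma exp_neg_pi_le : Real.exp (-Real.pi) ≤ 1 / 23 := by
  rw [Real.exp_neg, inv_eq_one_div]
  have h1 : (2.718 : ℝ) ≤ Real.exp 1 := by linarith [Real.exp_one_gt_d9]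
  have h3 : Real.exp 1 ^ 3 * Real.exp 0.1415 ≤ Real.exp Real.pi := by
    rw [← Real.exp_nat_mul, ← Real.exp_add]
    gcongr
    push_cast
    linarith [Real.pi_gt_d4]
  have h4 : (2.718 : ℝ) ^ 3 * Real.exp 0.1415 ≤ Real.exp 1 ^ 3 * Real.exp 0.1415 := by gcongr
  have h5 : (1.1515 : ℝ) ≤ Real.exp 0.1415 := by
    have := Real.quadratic_le_exp_of_nonneg (x := 0.1415) (by norm_num)
    linarith
  have h6 : (23 : ℝ) ≤ Real.exp Real.pi := by
    have : (2.718 : ℝ) ^ 3 * 1.1515 ≤ (2.718 : ℝ) ^ 3 * Real.exp 0.1415 := by gcongr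
    norm_num at this ⊢
    linarith
  gcongr

lemma exp_neg_mul_nat_le {c : ℝ} (hc : Real.pi ≤ c) (m : ℕ) :
    Real.exp (-(c * m)) ≤ (1 / 16) ^ m := by
  rw [show -(c * m) = m * -c by ring, Real.exp_nat_mul]
  have : Real.exp (-c) ≤ Real.exp (-Real.pi) := by gcongr
  gcongr
  linarith [exp_neg_pi_le]

lemma sqrt_pi_lt : Real.sqrt Real.pi < 1.773 := by
  rw [Real.sqrt_lt' (by norm_num)]
  linarith [Real.pi_lt_d4]

/-- Absorbs a linear factor by doubling the ratio of the geometric series. -/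
lemma succ_mul_pow_le (m : ℕ) : ((m : ℝ) + 1) * (1 / 16) ^ m ≤ (1 / 8) ^ m := by
  have h : ((m : ℝ) + 1) ≤ 2 ^ m := by
    exact_mod_cast Nat.lt_two_pow_self
  calc ((m : ℝ) + 1) * (1 / 16) ^ m ≤ 2 ^ m * (1 / 16) ^ m := by gcongr
    _ = _ := by rw [← mul_pow]; norm_num

/-- Summing up termwise estimates for the discretization error. -/
lemma discretization_of_terms {a : ℝ} {σ z D : ℂ} {T : ℕ → ℂ} (hσ : ‖σ‖ = 1) (ha : 1 ≤ a)
    (hT : HasSum (fun m : ℕ => σ ^ (m + 1) * T m) D)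
    (h1 : ∀ m, ‖T m‖ ≤ 4 * Real.exp (-a ^ 2) * (1 / 16) ^ m)
    (h2 : ∀ m : ℕ, Real.sqrt Real.pi * ‖z‖ * ‖T m‖ ≤
      (4 + 6 * Real.sqrt Real.pi * (a * (m + 1))) * Real.exp (-a ^ 2) * (1 / 16) ^ m) :
    ‖D‖ ≤ 5 * Real.exp (-a ^ 2) ∧
      Real.sqrt Real.pi * ‖z‖ * ‖D‖ ≤ 18 * a * Real.exp (-a ^ 2) := by
  have hE := Real.exp_pos (-a ^ 2)
  have hn : ∀ m, ‖σ ^ (m + 1) * T m‖ = ‖T m‖ := fun m => by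
    rw [norm_mul, norm_pow, hσ, one_pow, one_mul]
  constructor
  -- The sum is `4 · 16/15 < 5`.
  · have hg := (hasSum_geometric_of_lt_one (r := (1 / 16 : ℝ)) (by norm_num) (by norm_num)).mul_left
      (4 * Real.exp (-a ^ 2))
    have := hT.norm_le_of_bounded hg (fun m => by rw [hn]; exact h1 m)
    norm_num at this ⊢
    linarith
  -- Here `15` bounds `4 + 6√π`, and `15 · 8/7 < 18`.
  · have hg := (hasSum_geometric_of_lt_one (r := (1 / 8 : ℝ)) (by norm_num) (by norm_num)).mul_left
      (15 * a * Real.exp (-a ^ 2))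
    have hT2 := hT.mul_left ((Real.sqrt Real.pi * ‖z‖ : ℝ) : ℂ)
    have hc : ‖((Real.sqrt Real.pi * ‖z‖ : ℝ) : ℂ)‖ = Real.sqrt Real.pi * ‖z‖ := by
      rw [norm_real, Real.norm_of_nonneg (by positivity)]
    have := hT2.norm_le_of_bounded hg (fun m => by
      rw [norm_mul, hn, hc]
      refine (h2 m).trans ?_
      have h3 : 4 + 6 * Real.sqrt Real.pi * (a * (m + 1)) ≤ 15 * (a * (m + 1)) := by
        have h4 : 1 ≤ a * ((m : ℝ) + 1) :=
          one_le_mul_of_one_le_of_one_le ha (by linarith [Nat.cast_nonneg (α := ℝ) m])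
        nlinarith [sqrt_pi_lt]
      calc _ ≤ 15 * (a * (m + 1)) * Real.exp (-a ^ 2) * (1 / 16) ^ m := by gcongr
        _ = 15 * a * Real.exp (-a ^ 2) * (((m : ℝ) + 1) * (1 / 16) ^ m) := by ring
        _ ≤ _ := by gcongr; exact succ_mul_pow_le m)
    rw [norm_mul, hc] at this
    have h5 := mul_pos (lt_of_lt_of_le one_pos ha) hE
    norm_num at this ⊢
    nlinarith

lemma exp_neg_sq_succ_le {a : ℝ} (ha : Real.pi ≤ a ^ 2) (m : ℕ) :
    Real.exp (-(a * (m + 1)) ^ 2) ≤ Real.exp (-a ^ 2) * (1 / 16) ^ m := by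
  have h := exp_neg_mul_nat_le ha m
  calc Real.exp (-(a * (m + 1)) ^ 2) ≤ Real.exp (-a ^ 2) * Real.exp (-(a ^ 2 * m)) := by
        rw [← Real.exp_add]
        gcongr
        nlinarith [mul_nonneg (sq_nonneg a) (Nat.cast_nonneg (α := ℝ) m),
          mul_nonneg (sq_nonneg a) (sq_nonneg (m : ℝ))]
    _ ≤ _ := by gcongr

lemma norm_cexp_residue (z : ℂ) (b : ℝ) :
    ‖cexp (-z ^ 2) * cexp (2 * I * b * z)‖ =
      Real.exp (z.im ^ 2 - z.re ^ 2 - 2 * b * z.im) := by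
  rw [← Complex.exp_add, Complex.norm_exp]
  congr 1
  simp [sq]
  ring

/-- The modified rule in the region where the correction is applied: term estimates. -/
lemma term_sub_le {a b : ℝ} {z : ℂ} (ha : 1 ≤ a) (hb : a ≤ b) (hx : 0 ≤ z.re) (hz : 0 < z.im)
    (hreg : z.im ≤ a ∨ z.im < z.re) :
    ‖cexp (-(b : ℂ) ^ 2) * (w (z + I * b) - w (-z + I * b))‖ ≤ 4 * Real.exp (-b ^ 2) ∧
    Real.sqrt Real.pi * ‖z‖ * ‖cexp (-(b : ℂ) ^ 2) * (w (z + I * b) - w (-z + I * b))‖ ≤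
      (4 + 6 * Real.sqrt Real.pi * b) * Real.exp (-b ^ 2) := by
  have hb0 : 0 ≤ b := by linarith
  have hE := Real.exp_pos (-b ^ 2)
  have hp := sqrt_pi_pos
  have hv1 : 0 ≤ (z + I * b).im := by simp; linarith
  have A1 := norm_w_le_one hv1
  have A2 := mul_norm_w_le_of_norm_le hv1 (norm_le_norm_add_shift z hb0) hb0
  -- If `Im z ≤ b`, both `z + ib` and `-z + ib` lie in the closed upper half-plane. Otherwise the
  -- second is reflected back to `z - ib`, and the residue is small because `Im z < Re z`.
  rcases le_or_gt z.im b with hyb | hyb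
  · have hv2 : 0 ≤ (-z + I * b).im := by simp; linarith
    have B1 := norm_w_le_one hv2
    have B2 := mul_norm_w_le_of_norm_le hv2 (norm_le_norm_neg_add_shift z hb0) hb0
    have hs := norm_sub_le (w (z + I * b)) (w (-z + I * b))
    rw [norm_mul, norm_cexp_neg_sq]
    constructor
    · nlinarith
    · have : Real.sqrt Real.pi * ‖z‖ * ‖w (z + I * b) - w (-z + I * b)‖ ≤
          4 + 6 * Real.sqrt Real.pi * b := by
        calc _ ≤ Real.sqrt Real.pi * ‖z‖ * (‖w (z + I * b)‖ + ‖w (-z + I * b)‖) := by gcongr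
          _ ≤ _ := by nlinarith [mul_nonneg hp.le hb0]
      nlinarith
  · have hyx : z.im < z.re := by
      rcases hreg with h | h
      · linarith
      · exact h
    have hv2 : 0 ≤ (z - I * b).im := by simp; linarith
    have B1 := norm_w_le_one hv2
    have B2 := mul_norm_w_le_of_norm_le hv2 (norm_le_norm_sub_shift z hb0) hb0
    have e : cexp (-(b : ℂ) ^ 2) * (w (z + I * b) - w (-z + I * b)) =
        cexp (-(b : ℂ) ^ 2) * (w (z + I * b) + w (z - I * b)) -
        2 * (cexp (-z ^ 2) * cexp (2 * I * b * z)) := by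
      linear_combination -w_sub_shift z b
    have hn : ‖cexp (-(b : ℂ) ^ 2) * (w (z + I * b) - w (-z + I * b))‖ ≤
        Real.exp (-b ^ 2) * (‖w (z + I * b)‖ + ‖w (z - I * b)‖) +
        2 * Real.exp (z.im ^ 2 - z.re ^ 2 - 2 * b * z.im) := by
      rw [e]
      refine (norm_sub_le _ _).trans ?_
      rw [norm_mul, norm_cexp_neg_sq, norm_mul 2, norm_cexp_residue, Complex.norm_ofNat]
      gcongr
      exact norm_add_le _ _
    set x := z.re
    set y := z.im
    have hby : b * b ≤ b * y := by gcongr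
    constructor
    · refine hn.trans ?_
      have : Real.exp (y ^ 2 - x ^ 2 - 2 * b * y) ≤ Real.exp (-b ^ 2) := by
        gcongr
        nlinarith
      nlinarith
    · have hz2 : ‖z‖ ≤ 2 * x := by
        refine (Complex.norm_le_abs_re_add_abs_im z).trans ?_
        rw [abs_of_nonneg hx, abs_of_pos hz]
        linarith
      -- The weight `‖z‖ ≤ 2x` is unbounded for given `y`; the Gaussian factor trades `x` for `y`,
      -- via `1 + u ≤ e^u` and `y ≥ 1`.
      have h1 : x * Real.exp (y ^ 2 - x ^ 2) ≤ y := by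
        have h3 := Real.add_one_le_exp (x ^ 2 - y ^ 2)
        have h4 : Real.exp (x ^ 2 - y ^ 2) * Real.exp (y ^ 2 - x ^ 2) = 1 := by
          rw [← Real.exp_add]; simp
        have h5 : x ≤ y * Real.exp (x ^ 2 - y ^ 2) := by
          have hy1 : 1 ≤ y := by linarith
          have : x ≤ y * (x ^ 2 - y ^ 2 + 1) := by
            nlinarith [mul_nonneg (sub_nonneg.2 hyx.le) (by nlinarith : 0 ≤ y * (x + y) - 1)]
          nlinarith
        calc x * Real.exp (y ^ 2 - x ^ 2) ≤ y * Real.exp (x ^ 2 - y ^ 2) * Real.exp (y ^ 2 - x ^ 2) := by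
              gcongr
          _ = y := by rw [mul_assoc, h4, mul_one]
      -- Of the two factors `e^{-by}`, one absorbs `y` and the other supplies `e^{-b²}`.
      have h2 : y * Real.exp (-(b * y)) ≤ 1 := by
        have h3 : y ≤ Real.exp y := by linarith [Real.add_one_le_exp y]
        have h4 : Real.exp (-(b * y)) ≤ Real.exp (-y) := by
          gcongr
          nlinarith
        calc y * Real.exp (-(b * y)) ≤ Real.exp y * Real.exp (-y) := by gcongr
          _ = 1 := by rw [← Real.exp_add]; simp
      have h3 : ‖z‖ * Real.exp (y ^ 2 - x ^ 2 - 2 * b * y) ≤ 2 * Real.exp (-b ^ 2) := by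
        have e1 : Real.exp (y ^ 2 - x ^ 2 - 2 * b * y) =
            Real.exp (y ^ 2 - x ^ 2) * (Real.exp (-(b * y)) * Real.exp (-(b * y))) := by
          rw [← Real.exp_add, ← Real.exp_add]; congr 1; ring
        rw [e1]
        calc _ ≤ 2 * x * (Real.exp (y ^ 2 - x ^ 2) * (Real.exp (-(b * y)) * Real.exp (-(b * y)))) := by
              gcongr
          _ = 2 * (x * Real.exp (y ^ 2 - x ^ 2)) * (Real.exp (-(b * y)) * Real.exp (-(b * y))) := by
              ring
          _ ≤ 2 * y * (Real.exp (-(b * y)) * Real.exp (-(b * y))) := by gcongr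
          _ = 2 * (y * Real.exp (-(b * y))) * Real.exp (-(b * y)) := by ring
          _ ≤ 2 * 1 * Real.exp (-b ^ 2) := by
              gcongr
              nlinarith
          _ = _ := by ring
      calc _ ≤ Real.sqrt Real.pi * ‖z‖ * (Real.exp (-b ^ 2) * (‖w (z + I * b)‖ + ‖w (z - I * b)‖) +
            2 * Real.exp (y ^ 2 - x ^ 2 - 2 * b * y)) := by gcongr
        _ = Real.exp (-b ^ 2) * (Real.sqrt Real.pi * ‖z‖ * ‖w (z + I * b)‖ +
            Real.sqrt Real.pi * ‖z‖ * ‖w (z - I * b)‖) +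
            2 * Real.sqrt Real.pi * (‖z‖ * Real.exp (y ^ 2 - x ^ 2 - 2 * b * y)) := by ring
        _ ≤ Real.exp (-b ^ 2) * ((2 + Real.sqrt Real.pi * b) + (2 + Real.sqrt Real.pi * b)) +
            2 * Real.sqrt Real.pi * (2 * Real.exp (-b ^ 2)) := by gcongr
        _ ≤ _ := by
          have : Real.sqrt Real.pi * 1 ≤ Real.sqrt Real.pi * b := by gcongr; linarith
          nlinarith

/-- The unmodified rule far above the real axis: term estimates. -/
lemma term_add_le {a : ℝ} {z : ℂ} (hapi : Real.pi ≤ a ^ 2) (ha : 1 ≤ a) (m : ℕ) (hx : 0 ≤ z.re)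
    (hya : a ≤ z.im) (hyx : z.re ≤ z.im) :
    ‖cexp (-((a * (m + 1) : ℝ) : ℂ) ^ 2) * (w (z + I * ((a * (m + 1) : ℝ) : ℂ)) +
        w (z - I * ((a * (m + 1) : ℝ) : ℂ)))‖ ≤ 4 * Real.exp (-a ^ 2) * (1 / 16) ^ m ∧
    Real.sqrt Real.pi * ‖z‖ * ‖cexp (-((a * (m + 1) : ℝ) : ℂ) ^ 2) *
        (w (z + I * ((a * (m + 1) : ℝ) : ℂ)) + w (z - I * ((a * (m + 1) : ℝ) : ℂ)))‖ ≤
      (4 + 6 * Real.sqrt Real.pi * (a * (m + 1))) * Real.exp (-a ^ 2) * (1 / 16) ^ m := by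
  have hEb := exp_neg_sq_succ_le hapi m
  have hr := exp_neg_mul_nat_le hapi m
  have hm0 : (0 : ℝ) ≤ m := Nat.cast_nonneg m
  obtain ⟨b, hb⟩ : ∃ b : ℝ, b = a * (m + 1) := ⟨_, rfl⟩
  simp only [← hb] at hEb ⊢
  have hb0 : 0 ≤ b := by rw [hb]; positivity
  have hab : a ≤ b := by rw [hb]; nlinarith
  have hE := Real.exp_pos (-b ^ 2)
  have hp := sqrt_pi_pos
  have hv1 : 0 ≤ (z + I * b).im := by simp; linarith
  have A1 := norm_w_le_one hv1
  have A2 := mul_norm_w_le_of_norm_le hv1 (norm_le_norm_add_shift z hb0) hb0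
  obtain ⟨R, hR⟩ : ∃ R : ℝ, R = Real.exp (-a ^ 2) * (1 / 16) ^ m := ⟨_, rfl⟩
  have hR0 : 0 ≤ R := by rw [hR]; positivity
  rw [← hR] at hEb
  have goal_eq : ∀ c : ℝ, c * Real.exp (-a ^ 2) * (1 / 16) ^ m = c * R := fun c => by rw [hR]; ring
  rw [goal_eq, goal_eq]
  -- If `b ≤ Im z`, the shift `z - ib` stays in the upper half-plane and nothing is reflected.
  -- Otherwise the residue appears, but `‖z‖ ≤ 2b` controls the weight.
  rcases le_or_gt b z.im with hyb | hyb
  · have hv2 : 0 ≤ (z - I * b).im := by simp; linarith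
    have B1 := norm_w_le_one hv2
    have B2 := mul_norm_w_le_of_norm_le hv2 (norm_le_norm_sub_shift z hb0) hb0
    have hs := norm_add_le (w (z + I * b)) (w (z - I * b))
    rw [norm_mul, norm_cexp_neg_sq]
    constructor
    · nlinarith
    · have : Real.sqrt Real.pi * ‖z‖ * ‖w (z + I * b) + w (z - I * b)‖ ≤
          4 + 6 * Real.sqrt Real.pi * b := by
        calc _ ≤ Real.sqrt Real.pi * ‖z‖ * (‖w (z + I * b)‖ + ‖w (z - I * b)‖) := by gcongr
          _ ≤ _ := by nlinarith [mul_nonneg hp.le hb0]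
      calc _ = Real.sqrt Real.pi * ‖z‖ * ‖w (z + I * b) + w (z - I * b)‖ * Real.exp (-b ^ 2) := by ring
        _ ≤ _ := by gcongr
  · have hv2 : 0 ≤ (-z + I * b).im := by simp; linarith
    have B1 := norm_w_le_one hv2
    have B2 := mul_norm_w_le_of_norm_le hv2 (norm_le_norm_neg_add_shift z hb0) hb0
    have e : cexp (-(b : ℂ) ^ 2) * (w (z + I * b) + w (z - I * b)) =
        cexp (-(b : ℂ) ^ 2) * (w (z + I * b) - w (-z + I * b)) +
        2 * (cexp (-z ^ 2) * cexp (2 * I * b * z)) := by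
      linear_combination w_sub_shift z b
    have hn : ‖cexp (-(b : ℂ) ^ 2) * (w (z + I * b) + w (z - I * b))‖ ≤
        Real.exp (-b ^ 2) * (‖w (z + I * b)‖ + ‖w (-z + I * b)‖) +
        2 * Real.exp (z.im ^ 2 - z.re ^ 2 - 2 * b * z.im) := by
      rw [e]
      refine (norm_add_le _ _).trans ?_
      rw [norm_mul, norm_cexp_neg_sq, norm_mul 2, norm_cexp_residue, Complex.norm_ofNat]
      gcongr
      exact norm_sub_le _ _
    set x := z.re
    set y := z.im
    -- The function `y² - 2by` decreases on `[a, b]`, so it is at most `a² - 2ab = -a² - 2a²m`.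
    have hres : Real.exp (y ^ 2 - x ^ 2 - 2 * b * y) ≤ R := by
      rw [hR]
      refine le_trans ?_ (mul_le_mul_of_nonneg_left hr (Real.exp_pos _).le)
      rw [← Real.exp_add]
      gcongr
      have h1 : b * a = a ^ 2 * (m + 1) := by rw [hb]; ring
      nlinarith [mul_nonneg (sub_nonneg.2 hya) (sub_nonneg.2 hyb.le),
        mul_nonneg (sub_nonneg.2 hya) (sub_nonneg.2 hab), mul_nonneg (sq_nonneg a) hm0]
    have hz2 : ‖z‖ ≤ 2 * b := by
      refine (Complex.norm_le_abs_re_add_abs_im z).trans ?_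
      rw [abs_of_nonneg hx, abs_of_nonneg (by linarith : 0 ≤ z.im)]
      linarith
    constructor
    · refine hn.trans ?_
      nlinarith
    · calc _ ≤ Real.sqrt Real.pi * ‖z‖ * (Real.exp (-b ^ 2) * (‖w (z + I * b)‖ + ‖w (-z + I * b)‖) +
            2 * Real.exp (y ^ 2 - x ^ 2 - 2 * b * y)) := by gcongr
        _ = Real.exp (-b ^ 2) * (Real.sqrt Real.pi * ‖z‖ * ‖w (z + I * b)‖ +
            Real.sqrt Real.pi * ‖z‖ * ‖w (-z + I * b)‖) +
            2 * Real.sqrt Real.pi * (‖z‖ * Real.exp (y ^ 2 - x ^ 2 - 2 * b * y)) := by ring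
        _ ≤ R * ((2 + Real.sqrt Real.pi * b) + (2 + Real.sqrt Real.pi * b)) +
            2 * Real.sqrt Real.pi * (2 * b * R) := by gcongr
        _ = _ := by ring

/-! ### Step size, nodes and the truncation error. -/

noncomputable section

/-- The contribution of the pair of nodes `±t` to the quadrature rules. -/
def nodeTerm (h : ℝ) (z : ℂ) (t : ℝ) : ℂ :=
  2 * I * h * z / Real.pi * (cexp (-(t : ℂ) ^ 2) / (z ^ 2 - (t : ℂ) ^ 2))

lemma nodeTerm_eq {h : ℝ} {z : ℂ} (hz : 0 < z.im) (t : ℝ) :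
    I * h / Real.pi * (cexp (-(t : ℂ) ^ 2) / (z - t)) +
      I * h / Real.pi * (cexp (-((-t : ℝ) : ℂ) ^ 2) / (z - (-t : ℝ))) = nodeTerm h z t := by
  have h1 : z - t ≠ 0 := fun h0 => by
    have := congrArg im h0; simp at this; exact hz.ne' this
  have h2 : z + t ≠ 0 := fun h0 => by
    have := congrArg im h0; simp at this; exact hz.ne' this
  have h3 : z ^ 2 - (t : ℂ) ^ 2 ≠ 0 := by
    rw [sq_sub_sq]; exact mul_ne_zero h2 h1
  have hpi : (Real.pi : ℂ) ≠ 0 := by exact_mod_cast Real.pi_ne_zero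
  unfold nodeTerm
  push_cast
  rw [neg_sq, sub_neg_eq_add]
  field_simp
  ring

lemma step_pos (N : ℕ) : 0 < step N := by
  have := Real.pi_pos
  unfold step; positivity

lemma step_sq (N : ℕ) : ((N : ℝ) + 1) * step N ^ 2 = Real.pi := by
  have := Real.pi_pos
  unfold step
  rw [Real.sq_sqrt (by positivity)]
  field_simp

lemma pi_div_step_mul (N : ℕ) : Real.pi / step N * step N = Real.pi :=
  div_mul_cancel₀ _ (step_pos N).ne'

lemma pi_div_step_sq (N : ℕ) : (Real.pi / step N) ^ 2 = Real.pi * ((N : ℝ) + 1) := by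
  have h := step_sq N
  have h0 := step_pos N
  rw [div_pow, div_eq_iff (by positivity)]
  linear_combination -Real.pi * h

lemma pi_le_pi_div_step_sq (N : ℕ) : Real.pi ≤ (Real.pi / step N) ^ 2 := by
  rw [pi_div_step_sq]
  have := Real.pi_pos
  have : (0 : ℝ) ≤ N := Nat.cast_nonneg N
  nlinarith

lemma pi_div_step_pos (N : ℕ) : 0 < Real.pi / step N := div_pos Real.pi_pos (step_pos N)

lemma one_le_pi_div_step (N : ℕ) : 1 ≤ Real.pi / step N := by
  have h := pi_le_pi_div_step_sq N
  have h2 := pi_div_step_pos N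
  nlinarith [Real.pi_gt_three]

lemma pi_div_step_eq (N : ℕ) : Real.pi / step N = Real.sqrt Real.pi * Real.sqrt ((N : ℝ) + 1) := by
  rw [← Real.sqrt_mul Real.pi_pos.le, ← pi_div_step_sq, Real.sqrt_sq (pi_div_step_pos N).le]

/-- The error scale `e^{-π(N+1)}`. -/
def scale (N : ℕ) : ℝ := Real.exp (-(Real.pi / step N) ^ 2)

lemma scale_pos (N : ℕ) : 0 < scale N := Real.exp_pos _

/-- Because `(N+1)h² = π`, the square of `(N+1+j)h` is `π(N+1) + 2πj + j²h²`: the first omitted node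
already has weight of the discretization scale. -/
lemma exp_node_le (N j : ℕ) {t : ℝ} (ht : ((N : ℝ) + 1 + j) * step N ≤ t) :
    Real.exp (-t ^ 2) ≤ scale N * (1 / 16) ^ j := by
  have hpi := Real.pi_pos
  refine le_trans ?_ (mul_le_mul_of_nonneg_left
    (exp_neg_mul_nat_le (c := 2 * Real.pi) (by linarith) j) (scale_pos N).le)
  unfold scale
  rw [← Real.exp_add]
  gcongr
  rw [pi_div_step_sq]
  have h := step_sq N
  have h0 := step_pos N
  have hj : (0 : ℝ) ≤ j := Nat.cast_nonneg j
  have h1 : (((N : ℝ) + 1 + j) * step N) ^ 2 ≤ t ^ 2 := by gcongr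
  have h2 : (((N : ℝ) + 1 + j) * step N) ^ 2 =
      Real.pi * (N + 1) + 2 * Real.pi * j + j ^ 2 * step N ^ 2 := by
    linear_combination (N + 1 + 2 * j) * h
  nlinarith [mul_nonneg (sq_nonneg (j : ℝ)) (sq_nonneg (step N))]

/-- `z` keeps a safe distance from the poles `±t` near the node of index `k`. -/
def Away (h : ℝ) (k : ℕ) (z : ℂ) (t : ℝ) : Prop :=
  ‖z‖ * h ≤ 4 * ‖z ^ 2 - (t : ℂ) ^ 2‖ ∧ ‖z‖ ^ 2 ≤ (3 + 4 * k) * ‖z ^ 2 - (t : ℂ) ^ 2‖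

/-- From `‖z² - t²‖² = ‖z‖⁴ + t⁴ + 2t²(y² - x²)`: for `x ≤ y` this dominates both `‖z‖⁴` and
`‖z‖²t²`, so no distance to the nodes is needed. -/
lemma away_of_re_le_im {h t : ℝ} {z : ℂ} (hh : 0 < h) (k : ℕ) (ht : h ≤ t) (hx : 0 ≤ z.re)
    (hxy : z.re ≤ z.im) : Away h k z t := by
  have hsq : ‖z ^ 2 - (t : ℂ) ^ 2‖ ^ 2 = ‖z‖ ^ 4 + t ^ 4 + 2 * t ^ 2 * (z.im ^ 2 - z.re ^ 2) := by
    rw [← normSq_eq_norm_sq, show ‖z‖ ^ 4 = (‖z‖ ^ 2) ^ 2 by ring, ← normSq_eq_norm_sq,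
      normSq_apply, normSq_apply]
    simp [sq]
    ring
  have h0 : 0 ≤ z.im ^ 2 - z.re ^ 2 := by nlinarith
  have h1 : 0 ≤ 2 * t ^ 2 * (z.im ^ 2 - z.re ^ 2) := by positivity
  have hA : ‖z‖ ^ 2 ≤ ‖z ^ 2 - (t : ℂ) ^ 2‖ := by
    refine le_of_sq_le_sq ?_ (norm_nonneg _)
    rw [hsq]
    nlinarith [sq_nonneg (t ^ 2)]
  have hB : ‖z‖ * t ≤ ‖z ^ 2 - (t : ℂ) ^ 2‖ := by
    refine le_of_sq_le_sq ?_ (norm_nonneg _)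
    rw [hsq]
    nlinarith [sq_nonneg (‖z‖ ^ 2 - t ^ 2), sq_nonneg (t ^ 2), sq_nonneg (‖z‖ ^ 2)]
  have hn := norm_nonneg (z ^ 2 - (t : ℂ) ^ 2)
  have hk : (0 : ℝ) ≤ k := Nat.cast_nonneg k
  constructor
  · nlinarith [norm_nonneg z]
  · nlinarith [mul_nonneg hk hn]

/-- Factor `z² - t² = (z+t)(z-t)`, with `‖z+t‖ ≥ max(‖z‖, t)` and `‖z-t‖ ≥ h/4`. The `3 + 4k` is `1`
plus the `2 + 4k` that bounds `t²` through `t ≤ (k+1/2)h`. -/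
lemma away_of_le_abs {h t : ℝ} {z : ℂ} (hh : 0 < h) (k : ℕ) (ht : 0 ≤ t)
    (htk : t ≤ ((k : ℝ) + 1 / 2) * h) (hx : 0 ≤ z.re) (hd : h / 4 ≤ |z.re - t|) :
    Away h k z t := by
  have hn : ‖z ^ 2 - (t : ℂ) ^ 2‖ = ‖z + t‖ * ‖z - t‖ := by rw [sq_sub_sq, norm_mul]
  have h1 : h / 4 ≤ ‖z - t‖ := by
    refine hd.trans ?_
    have := abs_re_le_norm (z - t)
    simpa using this
  have h2 : ‖z‖ ≤ ‖z + t‖ := by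
    refine le_of_sq_le_sq ?_ (norm_nonneg _)
    rw [← normSq_eq_norm_sq, ← normSq_eq_norm_sq, normSq_apply, normSq_apply]
    simp
    nlinarith [mul_nonneg hx ht]
  have h3 : t ≤ ‖z + t‖ := by
    refine le_trans ?_ (re_le_norm _)
    simp [hx]
  have hp := norm_nonneg (z + t)
  have hk : (0 : ℝ) ≤ k := Nat.cast_nonneg k
  constructor
  · rw [hn]
    nlinarith [mul_le_mul h2 h1 (by positivity) hp]
  · have h4 : ‖z‖ ^ 2 ≤ ‖z ^ 2 - (t : ℂ) ^ 2‖ + t ^ 2 := by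
      have := norm_add_le (z ^ 2 - (t : ℂ) ^ 2) ((t : ℂ) ^ 2)
      rw [sub_add_cancel, norm_pow, norm_pow, norm_real, Real.norm_of_nonneg ht] at this
      exact this
    have h5 : t ^ 2 ≤ (2 + 4 * k) * ‖z ^ 2 - (t : ℂ) ^ 2‖ := by
      rw [hn]
      calc t ^ 2 = t * t := sq t
        _ ≤ (((k : ℝ) + 1 / 2) * h) * ‖z + t‖ := by gcongr
        _ = (2 + 4 * k) * (‖z + t‖ * (h / 4)) := by ring
        _ ≤ _ := by gcongr
    linarith

lemma norm_nodeTerm {h : ℝ} (hh : 0 < h) (z : ℂ) (t : ℝ) :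
    ‖nodeTerm h z t‖ =
      2 * h / Real.pi * Real.exp (-t ^ 2) * (‖z‖ / ‖z ^ 2 - (t : ℂ) ^ 2‖) := by
  unfold nodeTerm
  rw [norm_mul, norm_div, norm_div, norm_mul, norm_mul, norm_mul, norm_cexp_neg_sq, norm_I,
    norm_real, norm_real, Real.norm_of_nonneg hh.le, Real.norm_of_nonneg Real.pi_pos.le,
    Complex.norm_ofNat]
  ring

/-- The truncation error. -/
lemma tail_le (N : ℕ) {z D : ℂ} {t : ℕ → ℝ} (hD : HasSum (fun j => nodeTerm (step N) z (t j)) D)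
    (ht : ∀ j : ℕ, ((N : ℝ) + 1 + j) * step N ≤ t j)
    (haway : ∀ j : ℕ, Away (step N) (N + 1 + j) z (t j)) :
    ‖D‖ ≤ 3 * scale N ∧
      Real.sqrt Real.pi * ‖z‖ * ‖D‖ ≤ 16 * Real.sqrt ((N : ℝ) + 1) * scale N := by
  have hh := step_pos N
  have hE := scale_pos N
  have hpi := Real.pi_pos
  have hsp := sqrt_pi_pos
  constructor
  · have hg := (hasSum_geometric_of_lt_one (r := (1 / 16 : ℝ)) (by norm_num) (by norm_num)).mul_left
      (8 / Real.pi * scale N)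
    have := hD.norm_le_of_bounded hg (fun j => by
      rw [norm_nodeTerm hh]
      have h1 : ‖z‖ / ‖z ^ 2 - (t j : ℂ) ^ 2‖ ≤ 4 / step N := by
        refine div_le_of_le_mul₀ (norm_nonneg _) (by positivity) ?_
        rw [div_mul_eq_mul_div, le_div_iff₀ hh]
        exact (haway j).1
      calc _ ≤ 2 * step N / Real.pi * (scale N * (1 / 16) ^ j) * (4 / step N) := by
            gcongr
            exact exp_node_le N j (ht j)
        _ = _ := by field_simp; ring)
    refine this.trans ?_
    have h3 : 8 / Real.pi ≤ 8 / 3 := by gcongr; exact Real.pi_gt_three.le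
    norm_num at h3 ⊢
    have h4 : 8 / Real.pi ≤ 45 / 16 := by linarith
    calc 8 / Real.pi * scale N * (16 / 15) ≤ 45 / 16 * scale N * (16 / 15) := by gcongr
      _ = _ := by ring
  · have hr : 0 < Real.sqrt ((N : ℝ) + 1) := Real.sqrt_pos.2 (by positivity)
    have hr2 : Real.sqrt ((N : ℝ) + 1) ^ 2 = N + 1 := Real.sq_sqrt (by positivity)
    -- `14` is `2 · 7`, with `7(N+1)(j+1)` bounding the constant of `Away`; the sum is `14 · 8/7 =
    -- 16`.
    have hg := (hasSum_geometric_of_lt_one (r := (1 / 8 : ℝ)) (by norm_num) (by norm_num)).mul_left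
      (14 * Real.sqrt ((N : ℝ) + 1) * scale N)
    have hc : ‖((Real.sqrt Real.pi * ‖z‖ : ℝ) : ℂ)‖ = Real.sqrt Real.pi * ‖z‖ := by
      rw [norm_real, Real.norm_of_nonneg (by positivity)]
    have hstep : step N = Real.sqrt Real.pi / Real.sqrt ((N : ℝ) + 1) := by
      unfold step; rw [Real.sqrt_div hpi.le]
    have := (hD.mul_left ((Real.sqrt Real.pi * ‖z‖ : ℝ) : ℂ)).norm_le_of_bounded hg (fun j => by
      rw [norm_mul, hc, norm_nodeTerm hh]
      have hj : (0 : ℝ) ≤ j := Nat.cast_nonneg j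
      have hN : (0 : ℝ) ≤ N := Nat.cast_nonneg N
      have h1 : ‖z‖ ^ 2 / ‖z ^ 2 - (t j : ℂ) ^ 2‖ ≤ 3 + 4 * ((N + 1 + j : ℕ) : ℝ) :=
        div_le_of_le_mul₀ (norm_nonneg _) (by positivity) (haway j).2
      have h2 : 3 + 4 * ((N + 1 + j : ℕ) : ℝ) ≤ 7 * (N + 1) * (j + 1) := by
        push_cast
        nlinarith [mul_nonneg hN hj]
      have h3 := exp_node_le N j (ht j)
      calc _ = 2 / Real.sqrt ((N : ℝ) + 1) * Real.exp (-(t j) ^ 2) *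
              (‖z‖ ^ 2 / ‖z ^ 2 - (t j : ℂ) ^ 2‖) := by
            rw [hstep]
            have e1 : Real.sqrt Real.pi * Real.sqrt Real.pi / Real.pi = 1 := by
              rw [← sq, sq_sqrt_pi, div_self hpi.ne']
            calc _ = Real.sqrt Real.pi * Real.sqrt Real.pi / Real.pi *
                (2 / Real.sqrt ((N : ℝ) + 1) * Real.exp (-(t j) ^ 2) *
                  (‖z‖ ^ 2 / ‖z ^ 2 - (t j : ℂ) ^ 2‖)) := by ring
              _ = _ := by rw [e1, one_mul]
        _ ≤ 2 / Real.sqrt ((N : ℝ) + 1) * (scale N * (1 / 16) ^ j) *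
              (7 * (N + 1) * (j + 1)) := by
            gcongr
            exact h1.trans h2
        _ = 14 * Real.sqrt ((N : ℝ) + 1) * scale N * (((j : ℝ) + 1) * (1 / 16) ^ j) := by
            have e2 : 2 / Real.sqrt ((N : ℝ) + 1) * (N + 1) = 2 * Real.sqrt ((N : ℝ) + 1) := by
              rw [div_mul_eq_mul_div, div_eq_iff hr.ne']
              linear_combination -2 * hr2
            linear_combination 7 * ((j : ℝ) + 1) * scale N * (1 / 16) ^ j * e2
        _ ≤ _ := by gcongr; exact succ_mul_pow_le j)
    rw [norm_mul, hc] at this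
    refine this.trans (le_of_eq ?_)
    norm_num
    ring

/-! ### Assembling the pointwise error for each rule. -/

/-- The error estimates at a single point, in terms of the scale `e^{-π(N+1)}`. -/
def Close (N : ℕ) (z v : ℂ) : Prop :=
  ‖w z - v‖ ≤ 8 * scale N ∧
    Real.sqrt Real.pi * ‖z‖ * ‖w z - v‖ ≤ 48 * Real.sqrt ((N : ℝ) + 1) * scale N

/-- `T` is the truncation error and `D` the discretization error. The constants are `5 + 3 = 8` and
`18√π + 16 < 48`, as `π/h = √π √(N+1)`. -/
lemma close_of_split {N : ℕ} {z v D T : ℂ} (h : w z - v = T - D)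
    (hD : ‖D‖ ≤ 5 * scale N ∧
      Real.sqrt Real.pi * ‖z‖ * ‖D‖ ≤ 18 * (Real.pi / step N) * scale N)
    (hT : ‖T‖ ≤ 3 * scale N ∧
      Real.sqrt Real.pi * ‖z‖ * ‖T‖ ≤ 16 * Real.sqrt ((N : ℝ) + 1) * scale N) : Close N z v := by
  have hE := scale_pos N
  unfold Close
  rw [h]
  have hs := norm_sub_le T D
  constructor
  · linarith [hD.1, hT.1]
  · have hsp := sqrt_pi_lt
    have hr : 0 ≤ Real.sqrt ((N : ℝ) + 1) := Real.sqrt_nonneg _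
    have h1 : Real.pi / step N * scale N ≤ 1.773 * Real.sqrt ((N : ℝ) + 1) * scale N := by
      rw [pi_div_step_eq]; gcongr
    have h2 : 0 ≤ Real.sqrt ((N : ℝ) + 1) * scale N := by positivity
    calc _ ≤ Real.sqrt Real.pi * ‖z‖ * (‖T‖ + ‖D‖) := by gcongr
      _ ≤ _ := by nlinarith [hD.2, hT.2]

lemma discretization_sub {N : ℕ} {δ : ℝ} {σ z S : ℂ} (hx : 0 ≤ z.re) (hz : 0 < z.im)
    (hreg : z.im ≤ Real.pi / step N ∨ z.im < z.re)
    (hσ : cexp (2 * Real.pi * I * δ) = σ) (hσ2 : σ * σ = 1)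
    (hS : HasSum (fun n : ℤ => cexp (2 * Real.pi * I * δ * n) *
        (cexp (-((Real.pi / step N : ℝ) * n : ℂ) ^ 2) * w (z + I * ((Real.pi / step N : ℝ) * n)))) S) :
    ‖S - w z + 2 * cexp (-z ^ 2) / (1 - σ * cexp (-2 * I * Real.pi * z / step N))‖
        ≤ 5 * scale N ∧
      Real.sqrt Real.pi * ‖z‖ *
        ‖S - w z + 2 * cexp (-z ^ 2) / (1 - σ * cexp (-2 * I * Real.pi * z / step N))‖ ≤
          18 * (Real.pi / step N) * scale N := by
  have hσn : ‖σ‖ = 1 := by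
    have : ‖σ‖ * ‖σ‖ = 1 := by rw [← norm_mul, hσ2, norm_one]
    nlinarith [norm_nonneg σ]
  have ha := one_le_pi_div_step N
  have hapi := pi_le_pi_div_step_sq N
  have h := hasSum_shifted_sub (pi_div_step_pos N) hz hσ hσ2 hS
  have e : cexp (-(2 * I * (Real.pi / step N : ℝ) * z)) = cexp (-2 * I * Real.pi * z / step N) := by
    congr 1; push_cast; ring
  rw [e] at h
  have hb : ∀ m : ℕ, Real.pi / step N ≤ Real.pi / step N * ((m : ℝ) + 1) := fun m => by
    nlinarith [Nat.cast_nonneg (α := ℝ) m]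
  unfold scale
  refine discretization_of_terms hσn ha h (fun m => ?_) (fun m => ?_)
  · have h1 := (term_sub_le ha (hb m) hx hz hreg).1
    have h2 := exp_neg_sq_succ_le hapi m
    simp only [ofReal_mul _ ((m : ℝ) + 1), ofReal_add, ofReal_natCast, ofReal_one] at h1
    linarith
  · have h1 := (term_sub_le ha (hb m) hx hz hreg).2
    have h2 := exp_neg_sq_succ_le hapi m
    simp only [ofReal_mul _ ((m : ℝ) + 1), ofReal_add, ofReal_natCast, ofReal_one] at h1
    refine h1.trans ?_
    rw [mul_assoc _ (Real.exp _) (_ ^ m)]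
    gcongr

lemma discretization_add {N : ℕ} {δ : ℝ} {σ z S : ℂ} (hx : 0 ≤ z.re)
    (hya : Real.pi / step N ≤ z.im) (hyx : z.re ≤ z.im)
    (hσ : cexp (2 * Real.pi * I * δ) = σ) (hσ2 : σ * σ = 1)
    (hS : HasSum (fun n : ℤ => cexp (2 * Real.pi * I * δ * n) *
        (cexp (-((Real.pi / step N : ℝ) * n : ℂ) ^ 2) * w (z + I * ((Real.pi / step N : ℝ) * n)))) S) :
    ‖S - w z‖ ≤ 5 * scale N ∧
      Real.sqrt Real.pi * ‖z‖ * ‖S - w z‖ ≤ 18 * (Real.pi / step N) * scale N := by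
  have hσn : ‖σ‖ = 1 := by
    have : ‖σ‖ * ‖σ‖ = 1 := by rw [← norm_mul, hσ2, norm_one]
    nlinarith [norm_nonneg σ]
  have ha := one_le_pi_div_step N
  have hapi := pi_le_pi_div_step_sq N
  unfold scale
  refine discretization_of_terms hσn ha (hasSum_shifted_add hσ hσ2 hS) (fun m => ?_) (fun m => ?_)
  · have h1 := (term_add_le hapi ha m hx hya hyx).1
    simpa only [ofReal_mul _ ((m : ℝ) + 1), ofReal_add, ofReal_natCast, ofReal_one] using h1
  · have h1 := (term_add_le hapi ha m hx hya hyx).2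
    simpa only [ofReal_mul _ ((m : ℝ) + 1), ofReal_add, ofReal_natCast, ofReal_one] using h1

/-- The full midpoint sum, its truncation tail, and its expansion in shifted copies of `w`. -/
lemma midpoint_expansion (N : ℕ) {z : ℂ} (hz : 0 < z.im) :
    ∃ S : ℂ, HasSum (fun j : ℕ => nodeTerm (step N) z (midNode N (N + 1 + j))) (S - wM N z) ∧
      HasSum (fun n : ℤ => cexp (2 * Real.pi * I * (1 / 2 : ℝ) * n) *
        (cexp (-((Real.pi / step N : ℝ) * n : ℂ) ^ 2) *
          w (z + I * ((Real.pi / step N : ℝ) * n)))) S := by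
  obtain ⟨S, h1, h2⟩ := exists_hasSum_nodes (step_pos N) (pi_div_step_mul N) (1 / 2) hz
  refine ⟨S, ?_, h2⟩
  have h3 : HasSum (fun k : ℕ => nodeTerm (step N) z (midNode N k)) S := by
    convert! h1.nat_add_neg_add_one using 1
    ext k
    rw [← nodeTerm_eq hz]
    congr 1
    have : (((-((k : ℤ) + 1) : ℤ) : ℝ) + 1 / 2) * step N = -midNode N k := by
      unfold midNode; push_cast; ring
    rw [this]
  have h4 := (hasSum_nat_add_iff' (N + 1)).2 h3
  convert! h4 using 1
  · ext j
    rw [add_comm (N + 1) j]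
  · unfold wM nodeTerm
    rw [Finset.mul_sum]

/-- The full trapezoidal sum, its truncation tail, and its expansion in shifted copies of `w`. -/
lemma trapezoidal_expansion (N : ℕ) {z : ℂ} (hz : 0 < z.im) :
    ∃ S : ℂ, HasSum (fun j : ℕ => nodeTerm (step N) z (trapNode N (N + 1 + j)))
        (S - (I * step N / (Real.pi * z) + 2 * I * step N * z / Real.pi *
          ∑ k ∈ Finset.Icc 1 N, cexp (-(trapNode N k : ℂ) ^ 2) / (z ^ 2 - (trapNode N k : ℂ) ^ 2))) ∧
      HasSum (fun n : ℤ => cexp (2 * Real.pi * I * (0 : ℝ) * n) *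
        (cexp (-((Real.pi / step N : ℝ) * n : ℂ) ^ 2) *
          w (z + I * ((Real.pi / step N : ℝ) * n)))) S := by
  obtain ⟨S, h1, h2⟩ := exists_hasSum_nodes (step_pos N) (pi_div_step_mul N) 0 hz
  refine ⟨S, ?_, h2⟩
  have hz0 : z ≠ 0 := by rintro rfl; simp at hz
  have h3 : HasSum (fun m : ℕ => nodeTerm (step N) z (trapNode N (m + 1)))
      (S - I * step N / (Real.pi * z)) := by
    have h5 := (hasSum_nat_add_iff' 1).2 h1.nat_add_neg
    convert! h5 using 1
    · ext k
      rw [← nodeTerm_eq hz]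
      have e1 : (((((k + 1 : ℕ) : ℤ)) : ℝ) + 0) * step N = trapNode N (k + 1) := by
        unfold trapNode; push_cast; ring
      have e2 : (((-((k + 1 : ℕ) : ℤ) : ℤ) : ℝ) + 0) * step N = -trapNode N (k + 1) := by
        unfold trapNode; push_cast; ring
      rw [e1, e2]
    · simp
      have hpi : (Real.pi : ℂ) ≠ 0 := by exact_mod_cast Real.pi_ne_zero
      field_simp
  have h4 := (hasSum_nat_add_iff' N).2 h3
  convert! h4 using 1
  · ext j
    rw [show N + 1 + j = j + N + 1 by ring]
  · unfold nodeTerm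
    rw [← Finset.mul_sum, sub_sub]
    congr 3
    rw [Finset.range_eq_Ico, Finset.sum_Ico_add' (fun k : ℕ => cexp (-(trapNode N k : ℂ) ^ 2) /
      (z ^ 2 - (trapNode N k : ℂ) ^ 2)) 0 N 1, zero_add, Finset.Ico_add_one_right_eq_Icc]

end

lemma cexp_half : cexp (2 * Real.pi * I * ((1 / 2 : ℝ) : ℂ)) = -1 := by
  rw [← Complex.exp_pi_mul_I]; congr 1; push_cast; ring

lemma cexp_zero_shift : cexp (2 * Real.pi * I * ((0 : ℝ) : ℂ)) = 1 := by simp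

lemma le_midNode (N j : ℕ) : ((N : ℝ) + 1 + j) * step N ≤ midNode N (N + 1 + j) := by
  have := step_pos N
  unfold midNode
  push_cast
  exact mul_le_mul_of_nonneg_right (by linarith) this.le

lemma le_trapNode (N j : ℕ) : ((N : ℝ) + 1 + j) * step N ≤ trapNode N (N + 1 + j) := by
  unfold trapNode
  push_cast
  rfl

lemma step_le_of_le {N j : ℕ} {t : ℝ} (ht : ((N : ℝ) + 1 + j) * step N ≤ t) : step N ≤ t := by
  have := step_pos N
  have h1 : (0 : ℝ) ≤ N := Nat.cast_nonneg N
  have h2 : (0 : ℝ) ≤ j := Nat.cast_nonneg j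
  nlinarith [mul_nonneg (add_nonneg h1 h2) this.le]

lemma away_midNode {N : ℕ} {z : ℂ} (hx : 0 ≤ z.re)
    (h : z.re ≤ z.im ∨ ∀ n : ℤ, step N / 4 ≤ |z.re - (n + 1 / 2) * step N|) (j : ℕ) :
    Away (step N) (N + 1 + j) z (midNode N (N + 1 + j)) := by
  have hh := step_pos N
  have ht := step_le_of_le (le_midNode N j)
  rcases h with h | h
  · exact away_of_re_le_im hh _ ht hx h
  · refine away_of_le_abs hh _ (hh.le.trans ht) le_rfl hx ?_
    simpa [midNode] using h ((N + 1 + j : ℕ) : ℤ)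

lemma away_trapNode {N : ℕ} {z : ℂ} (hx : 0 ≤ z.re)
    (h : ∀ n : ℤ, step N / 4 ≤ |z.re - n * step N|) (j : ℕ) :
    Away (step N) (N + 1 + j) z (trapNode N (N + 1 + j)) := by
  have hh := step_pos N
  have ht := step_le_of_le (le_trapNode N j)
  refine away_of_le_abs hh _ (hh.le.trans ht) ?_ hx ?_
  · unfold trapNode
    gcongr
    linarith
  · simpa [trapNode] using h ((N + 1 + j : ℕ) : ℤ)

lemma close_wM {N : ℕ} {z : ℂ} (hx : 0 ≤ z.re) (hya : Real.pi / step N ≤ z.im)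
    (hyx : z.re ≤ z.im) : Close N z (wM N z) := by
  have hz : 0 < z.im := (pi_div_step_pos N).trans_le hya
  obtain ⟨S, h1, h2⟩ := midpoint_expansion N hz
  exact close_of_split (D := S - w z) (by ring)
    (discretization_add hx hya hyx cexp_half (by norm_num) h2)
    (tail_le N h1 (le_midNode N) (away_midNode hx (Or.inl hyx)))

lemma close_wMM_of_im_pos {N : ℕ} {z : ℂ} (hx : 0 ≤ z.re) (hz : 0 < z.im)
    (hreg : z.im ≤ Real.pi / step N ∨ z.im < z.re)
    (h : z.re ≤ z.im ∨ ∀ n : ℤ, step N / 4 ≤ |z.re - (n + 1 / 2) * step N|) :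
    Close N z (wMM N z) := by
  obtain ⟨S, h1, h2⟩ := midpoint_expansion N hz
  refine close_of_split ?_ (discretization_sub hx hz hreg cexp_half (by norm_num) h2)
    (tail_le N h1 (le_midNode N) (away_midNode hx h))
  unfold wMM
  rw [neg_one_mul, sub_neg_eq_add]
  ring

lemma close_wMT_of_im_pos {N : ℕ} {z : ℂ} (hx : 0 ≤ z.re) (hz : 0 < z.im)
    (hreg : z.im < z.re) (h : ∀ n : ℤ, step N / 4 ≤ |z.re - n * step N|) :
    Close N z (wMT N z) := by
  obtain ⟨S, h1, h2⟩ := trapezoidal_expansion N hz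
  refine close_of_split ?_ (discretization_sub hx hz (Or.inr hreg) cexp_zero_shift (by norm_num) h2)
    (tail_le N h1 (le_trapNode N) (away_trapNode hx h))
  unfold wMT
  rw [one_mul]
  ring

/-! ### Passage to the real axis. -/

/-- The estimates extend from above to the points of the real axis. -/
lemma close_ofReal {N : ℕ} {x : ℝ} {f : ℂ → ℂ} (hf : ContinuousAt f x)
    (h : ∀ᶠ ε : ℝ in 𝓝[>] 0, Close N (x + ε * I) (f (x + ε * I))) : Close N x (f x) := by
  have ht : Tendsto (fun ε : ℝ => (x : ℂ) + ε * I) (𝓝[>] 0) (𝓝 x) := by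
    have : Continuous (fun ε : ℝ => (x : ℂ) + ε * I) := by fun_prop
    have h2 := this.tendsto 0
    simp only [ofReal_zero, zero_mul, add_zero] at h2
    exact h2.mono_left nhdsWithin_le_nhds
  have hd : Tendsto (fun ε : ℝ => ‖w (x + ε * I) - f (x + ε * I)‖) (𝓝[>] 0) (𝓝 ‖w x - f x‖) :=
    (((continuous_w.tendsto _).comp ht).sub (hf.tendsto.comp ht)).norm
  exact ⟨le_of_tendsto hd (h.mono fun _ h => h.1),
    le_of_tendsto ((ht.norm.const_mul _).mul hd) (h.mono fun _ h => h.2)⟩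

lemma continuousAt_wMM {N : ℕ} {x : ℝ} (hx : ∀ n : ℤ, x ≠ (n + 1 / 2) * step N) :
    ContinuousAt (wMM N) x := by
  have hh := (step_pos N).ne'
  have hhc : (step N : ℂ) ≠ 0 := by exact_mod_cast hh
  have hpi : (Real.pi : ℂ) ≠ 0 := by exact_mod_cast Real.pi_ne_zero
  have h1 : 1 + cexp (-2 * I * (Real.pi : ℂ) * x / (step N : ℂ)) ≠ 0 := by
    intro h0
    have h2 : cexp (-2 * I * (Real.pi : ℂ) * x / (step N : ℂ) + Real.pi * I) = 1 := by
      rw [Complex.exp_add, Complex.exp_pi_mul_I]; linear_combination -h0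
    obtain ⟨n, hn⟩ := Complex.exp_eq_one_iff.1 h2
    apply hx (-n)
    have h3 : (x : ℂ) = (-n + 1 / 2) * step N := by
      have := I_ne_zero
      field_simp at hn ⊢
      linear_combination -hn
    apply ofReal_injective
    push_cast
    exact h3
  have h2 : ∀ k : ℕ, (x : ℂ) ^ 2 - (midNode N k : ℂ) ^ 2 ≠ 0 := by
    intro k h0
    rw [sq_sub_sq, mul_eq_zero] at h0
    rcases h0 with h0 | h0
    · have h3 : x + midNode N k = 0 := by exact_mod_cast h0
      apply hx (-k - 1)
      unfold midNode at h3
      push_cast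
      linear_combination h3
    · have h3 : x - midNode N k = 0 := by exact_mod_cast h0
      apply hx k
      unfold midNode at h3
      push_cast
      linear_combination h3
  unfold wMM wM
  refine ContinuousAt.add (ContinuousAt.div (by fun_prop) (by fun_prop) h1)
    (ContinuousAt.mul (by fun_prop) (tendsto_finsetSum _ fun k _ => ?_))
  exact ContinuousAt.div (by fun_prop) (by fun_prop) (h2 k)

lemma continuousAt_wMT {N : ℕ} {x : ℝ} (hx : ∀ n : ℤ, x ≠ n * step N) :
    ContinuousAt (wMT N) x := by
  have hh := (step_pos N).ne'
  have hhc : (step N : ℂ) ≠ 0 := by exact_mod_cast hh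
  have hpi : (Real.pi : ℂ) ≠ 0 := by exact_mod_cast Real.pi_ne_zero
  have h0 : (Real.pi : ℂ) * x ≠ 0 := by
    refine mul_ne_zero hpi ?_
    have := hx 0
    simp only [Int.cast_zero, zero_mul] at this
    exact_mod_cast this
  have h1 : 1 - cexp (-2 * I * (Real.pi : ℂ) * x / (step N : ℂ)) ≠ 0 := by
    intro h0
    have h2 : cexp (-2 * I * (Real.pi : ℂ) * x / (step N : ℂ)) = 1 := by
      linear_combination -h0
    obtain ⟨n, hn⟩ := Complex.exp_eq_one_iff.1 h2
    apply hx (-n)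
    have h3 : (x : ℂ) = -n * step N := by
      have := I_ne_zero
      field_simp at hn ⊢
      linear_combination -hn
    push_cast
    exact_mod_cast h3
  have h2 : ∀ k : ℕ, (x : ℂ) ^ 2 - (trapNode N k : ℂ) ^ 2 ≠ 0 := by
    intro k h0
    rw [sq_sub_sq, mul_eq_zero] at h0
    rcases h0 with h0 | h0
    · have h3 : x + trapNode N k = 0 := by exact_mod_cast h0
      apply hx (-k)
      unfold trapNode at h3
      push_cast
      linear_combination h3
    · have h3 : x - trapNode N k = 0 := by exact_mod_cast h0
      apply hx k
      unfold trapNode at h3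
      push_cast
      linear_combination h3
  unfold wMT
  refine ContinuousAt.add (ContinuousAt.add (ContinuousAt.div (by fun_prop) (by fun_prop) h1)
    (ContinuousAt.div (by fun_prop) (by fun_prop) h0))
    (ContinuousAt.mul (by fun_prop) (tendsto_finsetSum _ fun k _ => ?_))
  exact ContinuousAt.div (by fun_prop) (by fun_prop) (h2 k)

lemma eventually_lt_nhdsGT {c : ℝ} (hc : 0 < c) : ∀ᶠ ε : ℝ in 𝓝[>] 0, 0 < ε ∧ ε < c :=
  Ioo_mem_nhdsGT hc

lemma close_wMM {N : ℕ} {z : ℂ} (hx : 0 ≤ z.re) (hz : 0 ≤ z.im)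
    (hreg : z.im ≤ Real.pi / step N ∨ z.im < z.re)
    (h : z.re ≤ z.im ∨ ∀ n : ℤ, step N / 4 ≤ |z.re - (n + 1 / 2) * step N|) :
    Close N z (wMM N z) := by
  have hh := step_pos N
  rcases hz.lt_or_eq with hz | hz
  · exact close_wMM_of_im_pos hx hz hreg h
  · obtain ⟨x, rfl⟩ : ∃ x : ℝ, z = x := ⟨z.re, Complex.ext (by simp) (by simp [← hz])⟩
    simp only [ofReal_re, ofReal_im] at *
    -- On the axis `Re z ≤ Im z` leaves only the origin, which is not a midpoint node and from which
    -- the vertical approach stays in the region `Re z ≤ Im z`.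
    have h' : x = 0 ∨ ∀ n : ℤ, step N / 4 ≤ |x - (n + 1 / 2) * step N| :=
      h.imp (fun h => le_antisymm h hx) id
    refine close_ofReal (continuousAt_wMM ?_) ?_
    · rcases h' with rfl | h
      · intro n hn
        have h1 : (n : ℝ) + 1 / 2 = 0 := by
          rcases mul_eq_zero.1 hn.symm with h | h
          · exact h
          · exact absurd h hh.ne'
        have h2 : (2 * n + 1 : ℤ) = 0 := by
          have : (2 * (n : ℝ) + 1) = 0 := by linarith
          exact_mod_cast this
        omega
      · intro n hn
        have := h n
        rw [hn, sub_self, abs_zero] at this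
        linarith
    · filter_upwards [eventually_lt_nhdsGT (pi_div_step_pos N)] with ε hε
      refine close_wMM_of_im_pos (by simpa using hx) (by simpa using hε.1)
        (Or.inl (by simpa using hε.2.le)) ?_
      refine h'.imp (fun h0 => ?_) (fun h n => ?_)
      · simp [h0, hε.1.le]
      · simpa using h n

lemma close_wMT {N : ℕ} {z : ℂ} (hx : 0 ≤ z.re) (hz : 0 ≤ z.im)
    (hreg : z.im < z.re) (h : ∀ n : ℤ, step N / 4 ≤ |z.re - n * step N|) :
    Close N z (wMT N z) := by
  have hh := step_pos N
  rcases hz.lt_or_eq with hz | hz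
  · exact close_wMT_of_im_pos hx hz hreg h
  · obtain ⟨x, rfl⟩ : ∃ x : ℝ, z = x := ⟨z.re, Complex.ext (by simp) (by simp [← hz])⟩
    simp only [ofReal_re, ofReal_im] at *
    refine close_ofReal (continuousAt_wMT ?_) ?_
    · intro n hn
      have := h n
      rw [hn, sub_self, abs_zero] at this
      linarith
    · filter_upwards [eventually_lt_nhdsGT hreg] with ε hε
      refine close_wMT_of_im_pos (by simpa using hx) (by simpa using hε.1)
        (by simpa using hε.2) fun n => by simpa using h n

/-! ### The choice of rule, and extension by symmetry to the plane. -/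

lemma le_abs_sub_int_mul {h x : ℝ} (hh : 0 < h) (h1 : 1 / 4 ≤ Int.fract (x / h))
    (h2 : Int.fract (x / h) ≤ 3 / 4) (n : ℤ) : h / 4 ≤ |x - n * h| := by
  have e : x - n * h = (((⌊x / h⌋ - n : ℤ) : ℝ) + Int.fract (x / h)) * h := by
    have h3 := Int.floor_add_fract (x / h)
    have h4 : x = x / h * h := by field_simp
    push_cast
    linear_combination h4 - h * h3
  rw [e, abs_mul, abs_of_pos hh, div_eq_mul_one_div, mul_comm]
  gcongr
  generalize ⌊x / h⌋ - n = m
  rcases le_or_gt 0 m with hm | hm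
  · have : (0 : ℝ) ≤ m := by exact_mod_cast hm
    exact le_trans (by linarith) (le_abs_self _)
  · have : (m : ℝ) ≤ -1 := by exact_mod_cast (by omega : m ≤ -1)
    exact le_trans (by linarith) (neg_le_abs _)

lemma le_abs_sub_half_int_mul {h x : ℝ} (hh : 0 < h)
    (h1 : Int.fract (x / h) < 1 / 4 ∨ 3 / 4 < Int.fract (x / h)) (n : ℤ) :
    h / 4 ≤ |x - (n + 1 / 2) * h| := by
  have e : x - (n + 1 / 2) * h = (((⌊x / h⌋ - n : ℤ) : ℝ) + Int.fract (x / h) - 1 / 2) * h := by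
    have h3 := Int.floor_add_fract (x / h)
    have h4 : x = x / h * h := by field_simp
    push_cast
    linear_combination h4 - h * h3
  have hf0 := Int.fract_nonneg (x / h)
  have hf1 := Int.fract_lt_one (x / h)
  rw [e, abs_mul, abs_of_pos hh, div_eq_mul_one_div, mul_comm]
  gcongr
  generalize ⌊x / h⌋ - n = m
  rcases lt_trichotomy 0 m with hm | hm | hm
  · have : (1 : ℝ) ≤ m := by exact_mod_cast hm
    exact le_trans (by linarith) (le_abs_self _)
  · rw [← hm, Int.cast_zero, zero_add]
    rcases h1 with h1 | h1
    · exact le_trans (by linarith) (neg_le_abs _)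
    · exact le_trans (by linarith) (le_abs_self _)
  · have : (m : ℝ) ≤ -1 := by exact_mod_cast (by omega : m ≤ -1)
    exact le_trans (by linarith) (neg_le_abs _)

lemma close_wQuadrant (N : ℕ) {z : ℂ} (hx : 0 ≤ z.re) (hz : 0 ≤ z.im) :
    Close N z (wQuadrant N z) := by
  unfold wQuadrant
  split_ifs with h1 h2
  · exact close_wM hx ((le_max_right _ _).trans h1) ((le_max_left _ _).trans h1)
  · exact close_wMT hx hz h2.1 (le_abs_sub_int_mul (step_pos N) h2.2.1 h2.2.2)
  · refine close_wMM hx hz ?_ ?_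
    · rw [max_le_iff, not_and_or, not_le, not_le] at h1
      rcases h1 with h1 | h1
      · exact Or.inr h1
      · exact Or.inl h1.le
    · rcases lt_or_ge z.im z.re with hlt | hge
      · refine Or.inr (le_abs_sub_half_int_mul (step_pos N) ?_)
        by_contra! hcon
        exact h2 ⟨hlt, hcon⟩
      · exact Or.inl hge

lemma close_wUpper (N : ℕ) {z : ℂ} (hz : 0 ≤ z.im) : Close N z (wUpper N z) := by
  unfold wUpper
  split_ifs with h
  · have h1 := close_wQuadrant N (z := -(starRingEnd ℂ) z) (by simpa using h.le) (by simpa using hz)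
    have h2 : ‖w z - (starRingEnd ℂ) (wQuadrant N (-(starRingEnd ℂ) z))‖ =
        ‖w (-(starRingEnd ℂ) z) - wQuadrant N (-(starRingEnd ℂ) z)‖ := by
      rw [← conj_w, ← Complex.norm_conj, map_sub, Complex.conj_conj]
    have h3 : ‖-(starRingEnd ℂ) z‖ = ‖z‖ := by rw [norm_neg, Complex.norm_conj]
    unfold Close at h1 ⊢
    rw [h2, ← h3]
    exact h1
  · exact close_wQuadrant N (not_lt.1 h) hz

/-- `w` and its approximation extend to the lower half-plane by the same reflection formula, so the
error at `z` is minus the error at `-z`. -/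
lemma norm_sub_wApprox_le (N : ℕ) (z : ℂ) : ‖w z - wApprox N z‖ ≤ 8 * scale N := by
  unfold wApprox
  split_ifs with h
  · have h1 := (close_wUpper N (z := -z) (by simpa using h.le)).1
    have h2 : w z - (2 * cexp (-z ^ 2) - wUpper N (-z)) = -(w (-z) - wUpper N (-z)) := by
      linear_combination w_add_w_neg z
    rwa [h2, norm_neg]
  · exact (close_wUpper N (not_lt.1 h)).1

/-- Dividing by `‖w z‖` costs at most `1 + √π ‖z‖`, so the plain and weighted bounds add: `8 + 48 =
56`. -/
lemma relative_error_le (N : ℕ) {z : ℂ} (hz : 0 ≤ z.im) :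
    ‖w z - wApprox N z‖ / ‖w z‖ ≤ 56 * Real.sqrt ((N : ℝ) + 1) * scale N := by
  have hw : 0 < ‖w z‖ := norm_pos_iff.2 (w_ne_zero hz)
  have e : wApprox N z = wUpper N z := by
    unfold wApprox; rw [if_neg (not_lt.2 hz)]
  have h := close_wUpper N hz
  rw [← e] at h
  have hl := norm_w_lower hz
  have hE := scale_pos N
  have h1 : 1 ≤ Real.sqrt ((N : ℝ) + 1) := by
    rw [Real.one_le_sqrt]; linarith [Nat.cast_nonneg (α := ℝ) N]
  have h2 : (1 + Real.sqrt Real.pi * ‖z‖) * ‖w z - wApprox N z‖ ≤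
      56 * Real.sqrt ((N : ℝ) + 1) * scale N := by
    have h3 : scale N ≤ Real.sqrt ((N : ℝ) + 1) * scale N := by nlinarith
    linarith [h.1, h.2]
  rw [div_le_iff₀ hw]
  calc ‖w z - wApprox N z‖ ≤ ‖w z - wApprox N z‖ * ((1 + Real.sqrt Real.pi * ‖z‖) * ‖w z‖) :=
        le_mul_of_one_le_right (norm_nonneg _) hl
    _ = (1 + Real.sqrt Real.pi * ‖z‖) * ‖w z - wApprox N z‖ * ‖w z‖ := by ring
    _ ≤ _ := by gcongr

/-! ### Numerical evaluation of the constants. -/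

lemma scale_le (N : ℕ) : scale N ≤ 1 / 23 * Real.exp (-(Real.pi * (N : ℝ))) := by
  unfold scale
  rw [pi_div_step_sq, show -(Real.pi * ((N : ℝ) + 1)) = -Real.pi + -(Real.pi * N) by ring,
    Real.exp_add]
  gcongr
  exact exp_neg_pi_le

lemma exp_pi_bounds : 23.140 < Real.exp Real.pi ∧ Real.exp Real.pi < 23.142 := by
  have h1 := Real.exp_one_gt_d9
  have h2 := Real.exp_one_lt_d9
  have e : Real.exp Real.pi = Real.exp 1 ^ 3 * Real.exp (Real.pi - 3) := by
    rw [← Real.exp_nat_mul, ← Real.exp_add]; congr 1; push_cast; ring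
  have p1 := Real.pi_gt_d6
  have p2 := Real.pi_lt_d6
  have hl : (1.152105 : ℝ) ≤ Real.exp (Real.pi - 3) := by
    have h := Real.sum_le_exp_of_nonneg (x := 0.141592) (by norm_num) 5
    have h3 : Real.exp 0.141592 ≤ Real.exp (Real.pi - 3) := by gcongr; linarith
    refine le_trans ?_ (h.trans h3)
    norm_num [Finset.sum_range_succ, Nat.factorial]
  have hu : Real.exp (Real.pi - 3) ≤ 1.152111 := by
    have h := Real.exp_bound' (x := 0.141593) (by norm_num) (by norm_num) (n := 5) (by norm_num)
    have h3 : Real.exp (Real.pi - 3) ≤ Real.exp 0.141593 := by gcongr; linarith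
    refine h3.trans (h.trans ?_)
    norm_num [Finset.sum_range_succ, Nat.factorial]
  rw [e]
  constructor
  · calc (23.140 : ℝ) < 2.7182818283 ^ 3 * 1.152105 := by norm_num
      _ ≤ _ := by gcongr
  · calc _ ≤ (2.7182818286 : ℝ) ^ 3 * 1.152111 := by gcongr
      _ < _ := by norm_num

lemma sqrt_two_pi_bounds : 2.5066 < Real.sqrt (2 * Real.pi) ∧ Real.sqrt (2 * Real.pi) < 2.5067 := by
  have p1 := Real.pi_gt_d6
  have p2 := Real.pi_lt_d6
  constructor
  · rw [Real.lt_sqrt (by norm_num)]; linarith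
  · rw [Real.sqrt_lt' (by norm_num)]; linarith

lemma one_sub_exp_bounds :
    0.9770 < 1 - Real.exp (-2 * Real.pi + Real.sqrt (2 * Real.pi)) ∧
      1 - Real.exp (-2 * Real.pi + Real.sqrt (2 * Real.pi)) < 0.9772 := by
  have p1 := Real.pi_gt_d6
  have p2 := Real.pi_lt_d6
  obtain ⟨s1, s2⟩ := sqrt_two_pi_bounds
  have h1 := Real.exp_one_gt_d9
  have h2 := Real.exp_one_lt_d9
  -- Multiplying by `e⁴` moves the exponent to about `0.2235`, where a short Taylor polynomial
  -- suffices.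
  have key : Real.exp (-2 * Real.pi + Real.sqrt (2 * Real.pi)) * Real.exp 1 ^ 4 =
      Real.exp (4 - 2 * Real.pi + Real.sqrt (2 * Real.pi)) := by
    rw [← Real.exp_nat_mul, ← Real.exp_add]; congr 1; push_cast; ring
  have hl : (1.2502 : ℝ) ≤ Real.exp (4 - 2 * Real.pi + Real.sqrt (2 * Real.pi)) := by
    have h := Real.sum_le_exp_of_nonneg (x := 0.22341) (by norm_num) 5
    have h3 : Real.exp 0.22341 ≤ Real.exp (4 - 2 * Real.pi + Real.sqrt (2 * Real.pi)) := by
      gcongr; linarith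
    refine le_trans ?_ (h.trans h3)
    norm_num [Finset.sum_range_succ, Nat.factorial]
  have hu : Real.exp (4 - 2 * Real.pi + Real.sqrt (2 * Real.pi)) ≤ 1.2505 := by
    have h := Real.exp_bound' (x := 0.22352) (by norm_num) (by norm_num) (n := 5) (by norm_num)
    have h3 : Real.exp (4 - 2 * Real.pi + Real.sqrt (2 * Real.pi)) ≤ Real.exp 0.22352 := by
      gcongr; linarith
    refine h3.trans (h.trans ?_)
    norm_num [Finset.sum_range_succ, Nat.factorial]
  have q1 : (54.598 : ℝ) ≤ Real.exp 1 ^ 4 := by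
    calc (54.598 : ℝ) ≤ 2.7182818283 ^ 4 := by norm_num
      _ ≤ _ := by gcongr
  have q2 : Real.exp 1 ^ 4 ≤ (54.599 : ℝ) := by
    calc _ ≤ (2.7182818286 : ℝ) ^ 4 := by gcongr
      _ ≤ _ := by norm_num
  have hp := Real.exp_pos (-2 * Real.pi + Real.sqrt (2 * Real.pi))
  constructor <;> nlinarith

lemma constant_factor_bounds :
    (1.7724 < Real.sqrt Real.pi ∧ Real.sqrt Real.pi < 1.7725) ∧
    (1.4142 < Real.sqrt 2 ∧ Real.sqrt 2 < 1.41422) ∧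
    (2.9222 < Real.sqrt (Real.exp 1 * Real.pi) ∧ Real.sqrt (Real.exp 1 * Real.pi) < 2.9223) ∧
    (1.6487 < Real.sqrt (Real.exp 1) ∧ Real.sqrt (Real.exp 1) < 1.64873) := by
  have p1 := Real.pi_gt_d6
  have p2 := Real.pi_lt_d6
  have h1 := Real.exp_one_gt_d9
  have h2 := Real.exp_one_lt_d9
  have l1 : (2.7182818283 : ℝ) * 3.141592 ≤ Real.exp 1 * Real.pi := by gcongr
  have l2 : Real.exp 1 * Real.pi ≤ (2.7182818286 : ℝ) * 3.141593 := by gcongr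
  refine ⟨⟨?_, ?_⟩, ⟨?_, ?_⟩, ⟨?_, ?_⟩, ?_, ?_⟩
  all_goals first
    | rw [Real.lt_sqrt (by norm_num)]; norm_num at l1 l2 ⊢; linarith
    | rw [Real.sqrt_lt' (by norm_num)]; norm_num at l1 l2 ⊢; linarith
    | rw [Real.lt_sqrt (by norm_num)]; norm_num
    | rw [Real.sqrt_lt' (by norm_num)]; norm_num

lemma C₁_bounds : 0.6655 < C₁ ∧ C₁ < 0.6745 := by
  obtain ⟨a1, a2⟩ := exp_pi_bounds
  obtain ⟨d1, d2⟩ := one_sub_exp_bounds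
  obtain ⟨⟨b1, b2⟩, ⟨c1, c2⟩, ⟨f1, f2⟩, g1, g2⟩ := constant_factor_bounds
  have p1 := Real.pi_gt_d6
  have p2 := Real.pi_lt_d6
  have h1 := Real.exp_one_gt_d9
  have h2 := Real.exp_one_lt_d9
  unfold C₁
  constructor
  · calc (0.6655 : ℝ) < 2 * (2 * 2.7182818283 + 1.7724) / (23.142 * 2.9223 * 0.9772) +
          10 * 1.4142 * (1 + 2 * 3.141592) / (23.142 * 3.141593 ^ 2) := by norm_num
      _ ≤ _ := by gcongr
  · calc _ ≤ (2 * (2 * 2.7182818286 + 1.7725) / (23.140 * 2.9222 * 0.9770) +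
          10 * 1.41422 * (1 + 2 * 3.141593) / (23.140 * 3.141592 ^ 2) : ℝ) := by gcongr
      _ < _ := by norm_num

lemma C₂_bounds : 3.9655 < C₂ ∧ C₂ < 3.9745 := by
  obtain ⟨a1, a2⟩ := exp_pi_bounds
  obtain ⟨d1, d2⟩ := one_sub_exp_bounds
  obtain ⟨⟨b1, b2⟩, ⟨c1, c2⟩, ⟨f1, f2⟩, g1, g2⟩ := constant_factor_bounds
  have p1 := Real.pi_gt_d6
  have p2 := Real.pi_lt_d6
  have h1 := Real.exp_one_gt_d9
  have h2 := Real.exp_one_lt_d9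
  unfold C₂
  constructor
  · calc (3.9655 : ℝ) < 2 * 1.4142 * (1 + 1.7724) * (2 * 2.7182818283 + 1.7724) /
            (23.142 * 1.64873 * 0.9772) +
          10 * (1 + 2 * 3.141592) * (2 * 3.141592 + 1.4142) / (23.142 * 3.141593 ^ 2) := by
            norm_num
      _ ≤ _ := by gcongr
  · calc _ ≤ (2 * 1.41422 * (1 + 1.7725) * (2 * 2.7182818286 + 1.7725) /
            (23.140 * 1.6487 * 0.9770) +
          10 * (1 + 2 * 3.141593) * (2 * 3.141593 + 1.41422) / (23.140 * 3.141592 ^ 2) : ℝ) := by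
            gcongr
      _ < _ := by norm_num

end Faddeeva

theorem theorem1 :
    |Faddeeva.C₁ - 0.67| < 0.005 ∧ |Faddeeva.C₂ - 3.97| < 0.005 ∧
    ∀ N : ℕ,
      (∀ z : ℂ, ‖Faddeeva.w z - Faddeeva.wApprox N z‖ ≤
        Faddeeva.C₁ * Real.exp (-(Real.pi * (N : ℝ)))) ∧
      (∀ z : ℂ, 0 ≤ z.im → Faddeeva.w z ≠ 0 ∧
        ‖Faddeeva.w z - Faddeeva.wApprox N z‖ / ‖Faddeeva.w z‖ ≤
          Faddeeva.C₂ * Real.sqrt ((N : ℝ) + 1) * Real.exp (-(Real.pi * (N : ℝ)))) := by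
  obtain ⟨h1, h2⟩ := Faddeeva.C₁_bounds
  obtain ⟨h3, h4⟩ := Faddeeva.C₂_bounds
  refine ⟨by rw [abs_lt]; constructor <;> linarith, by rw [abs_lt]; constructor <;> linarith,
    fun N => ⟨fun z => ?_, fun z hz => ⟨Faddeeva.w_ne_zero hz, ?_⟩⟩⟩
  · have hs := Faddeeva.scale_le N
    have hp := Real.exp_pos (-(Real.pi * (N : ℝ)))
    refine (Faddeeva.norm_sub_wApprox_le N z).trans ?_
    -- `8/23 < 0.6655 < C₁`.
    nlinarith
  · have hs := Faddeeva.scale_le N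
    have hp := Real.exp_pos (-(Real.pi * (N : ℝ)))
    have hr := Real.sqrt_nonneg ((N : ℝ) + 1)
    refine (Faddeeva.relative_error_le N hz).trans ?_
    calc _ ≤ 56 * Real.sqrt ((N : ℝ) + 1) * (1 / 23 * Real.exp (-(Real.pi * (N : ℝ)))) := by gcongr
      _ = 56 / 23 * (Real.sqrt ((N : ℝ) + 1) * Real.exp (-(Real.pi * (N : ℝ)))) := by ring
      _ ≤ Faddeeva.C₂ * (Real.sqrt ((N : ℝ) + 1) * Real.exp (-(Real.pi * (N : ℝ)))) := by
          gcongr; linarith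
      _ = _ := by ring
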